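/- Let $G$ be a nilpotent Lie group (not necessarily connected) whose identity component $G^\circ$ is simply connected, let $\Gamma<G$ be a discrete cocompact subgroup, and let $\mu$ be the left-invariant Borel probability measure on $G/\Gamma$. Fix Mal'cev coordinates on $G/\Gamma$. These consist, first, of a Mal'cev basis $e_1,\dots,e_k$ of $G^\circ$: writing $t\mapsto e_j^t$ for the one-parameter subgroup with $e_j^1=e_j$, the $e_j$ are listed along the lower central series $(G^\circ)_1=G^\circ\supset(G^\circ)_2\supset\cdots$ of $G^\circ$, those belonging to step $i$ lie in $(G^\circ)_i$ and form a basis of the real vector space $(G^\circ)_i/(G^\circ)_{i+1}$, and $e_1^{t_1}\cdots e_k^{t_k}\in\Gamma$ if and only if $t_1,\dots,t_k\in\mathbb Z$. They consist, secondly, of a set of representatives $b$ of the classes $bG^\circ\Gamma$ (the connected components of $G/\Gamma$), with $G^\circ\Gamma$ represented by $1$; if $G/\Gamma$ is connected, this is just $\{1\}$. Put $D=\{e_1^{t_1}\cdots e_k^{t_k} : 0\le t_j<1\}$. The fractional part $\{x\}$ of $x\in G$ is the unique element of $\bigcup_b bD$ with $x\in\{x\}\Gamma$. Let $G=G_0=G_1\supset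 G_2\supset\cdots\supset G_{d+1}=1$ be the lower central series of $G$ and let $$g(n)=g_0^{\binom n0}g_1^{\binom n1}\cdots g_d^{\binom nd}\quad(n\in\mathbb Z),\qquad g_i\in G_i,$$ be a polynomial sequence such that $(g(n)\Gamma)_{n\ge0}$ is equidistributed in $G/\Gamma$, i.e. $\frac1N\sum_{n=0}^{N-1}f(g(n)\Gamma)\to\int f\,d\mu$ as $N\to\infty$ for every continuous $f\colon G/\Gamma\to\mathbb R$. If $H<G$ is a closed (Lie) subgroup such that $\{g(n)\}\in H$ for infinitely many $n\in\mathbb Z$, then $H\supset G^\circ$. -/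

import Mathlib

open Filter Topology MeasureTheory
open scoped Manifold ContDiff

/-- A sequence `g : ℤ → G` in a nilpotent group, with lower central series
`G = G₀ = G₁ ⊇ G₂ ⊇ ⋯ ⊇ G_{d+1} = 1`, is *polynomial* if
`g n = g₀ ^ binom(n, 0) * g₁ ^ binom(n, 1) * ⋯ * g_d ^ binom(n, d)` with `gᵢ ∈ Gᵢ`.
Here `(⊤ : Subgroup G).lowerCentralSeries i` is `G_{i+1}` in this numbering, so `Gᵢ` is
`(⊤ : Subgroup G).lowerCentralSeries (i - 1)` (truncated subtraction gives `G₀ = G₁ = G`). -/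
def IsPolynomialSequence {G : Type*} [Group G] [Group.IsNilpotent G] (g : ℤ → G) : Prop :=
  ∃ c : ℕ → G, (∀ i, c i ∈ (⊤ : Subgroup G).lowerCentralSeries (i - 1)) ∧
    ∀ n : ℤ, g n =
      ((List.range (Group.nilpotencyClass G + 1)).map fun i => c i ^ Ring.choose n i).prod

/-- The sequence `(g n Γ)_{n ≥ 0}` is equidistributed in `G ⧸ Γ` with respect to the
left-invariant Borel probability measure. -/
def IsEquidistributed {G : Type*} [Group G] [TopologicalSpace G] (Γ : Subgroup G)
    [MeasurableSpace (G ⧸ Γ)] [BorelSpace (G ⧸ Γ)] (g : ℤ → G) : Prop :=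
  ∃ μ : Measure (G ⧸ Γ), IsProbabilityMeasure μ ∧ SMulInvariantMeasure G (G ⧸ Γ) μ ∧
    ∀ f : C(G ⧸ Γ, ℝ),
      Tendsto (fun N : ℕ => (∑ n ∈ Finset.range N, f (g (n : ℤ) : G ⧸ Γ)) / (N : ℝ)) atTop
        (𝓝 (∫ x, f x ∂μ))

/-- A *Mal'cev basis* of a (connected, simply connected) nilpotent Lie group `N`, compatible with
the lattice `Λ`. The basis elements are `eⱼ = oneParam j 1`, and `oneParam j t` is `eⱼ ^ t`. -/
structure MalcevBasis (N : Type*) [Group N] [TopologicalSpace N] (Λ : Subgroup N) where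
  /-- The number `k` of basis elements. -/
  dim : ℕ
  /-- The one-parameter subgroups `t ↦ eⱼ ^ t`. -/
  oneParam : Fin dim → (Multiplicative ℝ →ₜ* N)
  /-- The place of `eⱼ` in the lower central series (counted from `0`). -/
  level : Fin dim → ℕ
  /-- The basis is listed along the lower central series. -/
  level_mono : Monotone level
  mem_lowerCentralSeries : ∀ j t,
    oneParam j (Multiplicative.ofAdd t) ∈ (⊤ : Subgroup N).lowerCentralSeries (level j)
  /-- The images of the `eⱼ` of level `i` are a basis of the real vector space
  `Nᵢ / Nᵢ₊₁` of consecutive lower central terms (`i ≥ 0`), on which a real number `t` acts by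
  `x ↦ x ^ t`: each class is in exactly one way a product of real powers of these `eⱼ`. -/
  existsUnique_of_level : ∀ i, ∀ x ∈ (⊤ : Subgroup N).lowerCentralSeries i,
    ∃! t : Fin dim → ℝ, (∀ j, level j ≠ i → t j = 0) ∧
      x⁻¹ * (List.ofFn fun j => oneParam j (Multiplicative.ofAdd (t j))).prod ∈
        (⊤ : Subgroup N).lowerCentralSeries (i + 1)
  /-- Compatibility: `e₁ ^ t₁ ⋯ e_k ^ t_k` lies in `Λ` iff all the `tⱼ` are integers. -/
  mem_lattice_iff : ∀ t : Fin dim → ℝ,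
    (List.ofFn fun j => oneParam j (Multiplicative.ofAdd (t j))).prod ∈ Λ ↔
      ∀ j, ∃ m : ℤ, t j = m

/-- The fundamental domain `{e₁ ^ t₁ ⋯ e_k ^ t_k | 0 ≤ tⱼ < 1}` of a Mal'cev basis. -/
def MalcevBasis.fundamentalDomain {N : Type*} [Group N] [TopologicalSpace N] {Λ : Subgroup N}
    (B : MalcevBasis N Λ) : Set N :=
  {x | ∃ t : Fin B.dim → ℝ, (∀ j, t j ∈ Set.Ico (0 : ℝ) 1) ∧
    x = (List.ofFn fun j => B.oneParam j (Multiplicative.ofAdd (t j))).prod}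

/-- *Mal'cev coordinates* on `G ⧸ Γ`: a Mal'cev basis of the identity component `G°`, compatible
with `Γ ∩ G°`, together with a choice of a base point in each connected component of `G ⧸ Γ`,
that is, of one representative `b` in each class `b G° Γ`, the class `G° Γ` being represented
by `1`. If `G ⧸ Γ` is connected, then `G = G° Γ` and `reps = {1}`, so that the basis is the only
datum. -/
structure MalcevCoordinates (G : Type*) [Group G] [TopologicalSpace G] [IsTopologicalGroup G]
    (Γ : Subgroup G) where
  basis : MalcevBasis (Subgroup.connectedComponentOfOne G)
    (Γ.subgroupOf (Subgroup.connectedComponentOfOne G))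
  reps : Set G
  one_mem_reps : 1 ∈ reps
  existsUnique_rep : ∀ x : G, ∃! b : G, b ∈ reps ∧
    ∃ h ∈ Subgroup.connectedComponentOfOne G, ∃ γ ∈ Γ, x = b * h * γ

/-- `y` is the fractional part `{x}` of `x`: `x = {x} [x]`, where the integral part `[x]` lies in
`Γ` and `{x}` lies in the fundamental domain of `G`, the union over the representatives `b` of
the translates `b D` of the fundamental domain `D ⊆ G°` of the Mal'cev basis. -/
def MalcevCoordinates.IsFractionalPart {G : Type*} [Group G] [TopologicalSpace G]
    [IsTopologicalGroup G] {Γ : Subgroup G} (C : MalcevCoordinates G Γ) (x y : G) : Prop :=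
  (∃ b ∈ C.reps, ∃ d ∈ C.basis.fundamentalDomain, y = b * (d : G)) ∧ ∃ γ ∈ Γ, x = y * γ

open scoped commutatorElement

/-! Let N = G° and suppose that N is not contained in H. A closed subgroup of a nilpotent group with
dense image in the abelianization is the whole group (`eq_top_of_topologicalClosure_sup_eq_top`).
Hence H ∩ N has non-dense image under the coordinate map θ : N → N/[N,N] = ℝ^s, and some nonzero
real linear form l is integral on that image (`MalcevBasis.exists_linearMap_int_of_ne_top`).

By pigeonhole, infinitely many of the given n have the same representative b, so {g(n)} = b·d(n)
with d(n) in the fundamental domain. Quotients of the d(n) lie in H ∩ N, so the values l(θ(d(n)))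
are congruent modulo 1; they are also bounded. Hence one value c is taken infinitely often.

Characters of N trivial on N ∩ Γ extend to functions on NΓ that are right invariant under Γ.
Nilpotency makes these functions vanish under repeated differences, so along a suitable progression
r + qℤ the coordinates of b⁻¹g are real polynomials p_j modulo 1
(`exists_torusFun_mem_unipotentFunctions`, `exists_period_powProd`). Infinitely often l, applied to
bounded representatives of the p_j(n) modulo 1, equals c. Although l has real coefficients, a
ℚ-linear functional on ℝ produces a nonzero integral combination of the p_j that is constant modulo
1 for every n (`exists_int_combination_eq_const`).

Thus a nontrivial character is constant on a progression of density 1/q. A tent function around that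
constant has integral at most 1/(2q) but limiting average at least 1/q, contradicting
equidistribution (`not_isEquidistributed_of_torusFun_eq_const`). -/

/-! ### Closed subgroups of nilpotent groups and the abelianization -/

theorem commutator_lowerCentralSeries_one_le {N : Type*} [Group N] (i : ℕ) :
    ⁅(⊤ : Subgroup N).lowerCentralSeries i, (⊤ : Subgroup N).lowerCentralSeries 1⁆ ≤
      (⊤ : Subgroup N).lowerCentralSeries (i + 2) := by
  set K := (⊤ : Subgroup N).lowerCentralSeries (i + 2) with hK
  set L := (⊤ : Subgroup N).lowerCentralSeries i with hL
  have key : ⁅⁅(⊤ : Subgroup (N ⧸ K)), (⊤ : Subgroup (N ⧸ K))⁆, L.map (QuotientGroup.mk' K)⁆ = ⊥ := by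
    have ht : (⊤ : Subgroup (N ⧸ K)) = (⊤ : Subgroup N).map (QuotientGroup.mk' K) := by
      rw [← MonoidHom.range_eq_map, QuotientGroup.range_mk']
    have h0 : ⁅⁅L.map (QuotientGroup.mk' K), (⊤ : Subgroup (N ⧸ K))⁆, (⊤ : Subgroup (N ⧸ K))⁆ = ⊥ := by
      rw [ht, ← Subgroup.map_commutator, ← Subgroup.map_commutator,
        (Subgroup.map_eq_bot_iff _), QuotientGroup.ker_mk']
      exact le_rfl
    -- Three subgroups lemma in N/K: two of the three cyclic double commutators of ⊤, ⊤, L are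
    -- trivial, both being `h0` up to symmetry.
    refine Subgroup.commutator_commutator_eq_bot_of_rotate ?_ h0
    rwa [Subgroup.commutator_comm ⊤ (L.map _)]
  rw [Subgroup.commutator_comm, ← QuotientGroup.ker_mk' K, ← Subgroup.map_eq_bot_iff,
    Subgroup.map_commutator, ← key]
  congr 1
  change Subgroup.map _ ⁅⊤, ⊤⁆ = _
  rw [Subgroup.map_commutator, ← MonoidHom.range_eq_map, QuotientGroup.range_mk']

/-- Modulo term i + 2 the element z is central and k commutes with w, so ⁅k z, h w⁆ has the same
class as ⁅k, h⁆, which lies in H. -/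
theorem commutator_mul_mul_mem {N : Type*} [Group N] {H : Subgroup N} {i : ℕ} {k z h w : N}
    (hk : k ∈ (⊤ : Subgroup N).lowerCentralSeries i) (hkH : k ∈ H)
    (hz : z ∈ (⊤ : Subgroup N).lowerCentralSeries (i + 1)) (hh : h ∈ H)
    (hw : w ∈ (⊤ : Subgroup N).lowerCentralSeries 1) :
    ⁅k * z, h * w⁆ ∈ (H ⊓ (⊤ : Subgroup N).lowerCentralSeries (i + 1)) ⊔
      (⊤ : Subgroup N).lowerCentralSeries (i + 2) := by
  have hmem : ⁅k, h⁆⁻¹ * ⁅k * z, h * w⁆ ∈ (⊤ : Subgroup N).lowerCentralSeries (i + 2) := by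
    set K := (⊤ : Subgroup N).lowerCentralSeries (i + 2) with hK
    rw [← QuotientGroup.eq]
    let π := QuotientGroup.mk' K
    have comm : ∀ a b : N, ⁅a, b⁆ ∈ K → Commute (π a) (π b) := by
      intro a b hab
      rw [← commutatorElement_eq_one_iff_commute, ← map_commutatorElement]
      exact (QuotientGroup.eq_one_iff _).2 hab
    have c1 : Commute (π z) (π h * π w) := by
      rw [← map_mul]
      exact comm _ _ (Subgroup.commutator_mem_commutator hz (Subgroup.mem_top _))
    have c2 : Commute (π k) (π w) := comm _ _
      (commutator_lowerCentralSeries_one_le i (Subgroup.commutator_mem_commutator hk hw))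
    change π ⁅k, h⁆ = π ⁅k * z, h * w⁆
    simp only [commutatorElement_def, map_mul, map_inv]
    calc π k * π h * (π k)⁻¹ * (π h)⁻¹
        = π k * π h * (π w * (π k)⁻¹ * (π w)⁻¹) * (π h)⁻¹ := by
          rw [(c2.inv_left.symm).eq, mul_assoc (π k)⁻¹, mul_inv_cancel, mul_one]
      _ = π k * ((π h * π w) * π z * (π z)⁻¹) * (π k)⁻¹ * (π w)⁻¹ * (π h)⁻¹ := by group
      _ = π k * (π z * (π h * π w) * (π z)⁻¹) * (π k)⁻¹ * (π w)⁻¹ * (π h)⁻¹ := by rw [c1.eq]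
      _ = _ := by group
  have hc : ⁅k, h⁆ ∈ H ⊓ (⊤ : Subgroup N).lowerCentralSeries (i + 1) := by
    refine ⟨?_, Subgroup.commutator_mem_commutator hk (Subgroup.mem_top _)⟩
    rw [commutatorElement_def]
    exact H.mul_mem (H.mul_mem (H.mul_mem hkH hh) (H.inv_mem hkH)) (H.inv_mem hh)
  have := Subgroup.mul_mem_sup hc hmem
  rwa [mul_inv_cancel_left] at this

/-- Density passes down the series: term i + 1 is generated by commutators, the commutator map is
continuous, and on the dense subsets `commutator_mul_mul_mem` applies. -/
theorem lowerCentralSeries_le_topologicalClosure {N : Type*} [Group N] [TopologicalSpace N]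
    [IsTopologicalGroup N] {H : Subgroup N}
    (hd : (H ⊔ (⊤ : Subgroup N).lowerCentralSeries 1).topologicalClosure = ⊤) (i : ℕ) :
    (⊤ : Subgroup N).lowerCentralSeries i ≤
      ((H ⊓ (⊤ : Subgroup N).lowerCentralSeries i) ⊔
        (⊤ : Subgroup N).lowerCentralSeries (i + 1)).topologicalClosure := by
  induction i with
  | zero => simpa using hd.ge
  | succ i ih =>
    change ⁅_, _⁆ ≤ _
    rw [Subgroup.commutator_le]
    intro a ha x _
    have hx : x ∈ (H ⊔ (⊤ : Subgroup N).lowerCentralSeries 1).topologicalClosure := by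
      rw [hd]; exact Subgroup.mem_top x
    have hcont : Continuous (Function.uncurry fun a x : N => ⁅a, x⁆) := by
      simp only [Function.uncurry_def, commutatorElement_def]
      fun_prop
    refine map_mem_closure₂ hcont (ih ha) hx ?_
    intro a ha x hx
    obtain ⟨k, hk, z, hz, rfl⟩ := Subgroup.mem_sup_of_normal_right.1 ha
    obtain ⟨h, hh, w, hw, rfl⟩ := Subgroup.mem_sup_of_normal_right.1 hx
    exact commutator_mul_mul_mem hk.2 hk.1 hz hh hw

/-- A closed subgroup of a nilpotent topological group whose image in the abelianization is dense
is the whole group. -/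
theorem eq_top_of_topologicalClosure_sup_eq_top {N : Type*} [Group N] [TopologicalSpace N]
    [IsTopologicalGroup N] [Group.IsNilpotent N] {H : Subgroup N} (hH : IsClosed (H : Set N))
    (hd : (H ⊔ (⊤ : Subgroup N).lowerCentralSeries 1).topologicalClosure = ⊤) : H = ⊤ := by
  obtain ⟨n, hn⟩ := Subgroup.nilpotent_iff_lowerCentralSeries.1 ‹Group.IsNilpotent N›
  -- Climbing up from the trivial term: once term i + 1 lies in the closed subgroup H, the density
  -- statement puts term i into H.
  have key : ∀ j ≤ n, (⊤ : Subgroup N).lowerCentralSeries (n - j) ≤ H := by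
    intro j
    induction j with
    | zero => intro _; simp [hn]
    | succ j ih =>
      intro hj
      have h1 := ih (by omega)
      have h2 : n - (j + 1) + 1 = n - j := by omega
      refine (lowerCentralSeries_le_topologicalClosure hd _).trans ?_
      refine Subgroup.topologicalClosure_minimal _ (sup_le inf_le_left ?_) hH
      rwa [h2]
  simpa using key n le_rfl

/-! ### Closed subgroups of finite-dimensional real vector spaces -/

/-- The largest linear subspace contained in an additive subgroup. -/
def AddSubgroup.maximalSubspace {E : Type*} [AddCommGroup E] [Module ℝ E] (A : AddSubgroup E) :
    Submodule ℝ E where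
  carrier := {v | ∀ t : ℝ, t • v ∈ A}
  add_mem' := fun ha hb t => by rw [smul_add]; exact A.add_mem (ha t) (hb t)
  zero_mem' := fun t => by simp
  smul_mem' := fun c v hv t => by rw [smul_smul]; exact hv _

/-- Let u be a limit of the directions of nonzero vectors a n → 0 in A ∩ W. The multiples ⌊t / ‖a
n‖⌋ • a n lie in A and converge to t • u along a subsequence, so the whole line ℝu lies in the
closed subgroup A. -/
theorem AddSubgroup.exists_mem_maximalSubspace_of_forall_exists_norm_lt {E : Type*}
    [NormedAddCommGroup E] [NormedSpace ℝ E] [FiniteDimensional ℝ E] {A : AddSubgroup E}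
    (hA : IsClosed (A : Set E)) (W : Submodule ℝ E)
    (h : ∀ ε > 0, ∃ a ∈ A, a ∈ W ∧ a ≠ 0 ∧ ‖a‖ < ε) :
    ∃ u ∈ A.maximalSubspace, u ∈ W ∧ u ≠ 0 := by
  have : ∀ n : ℕ, ∃ a ∈ A, a ∈ W ∧ a ≠ 0 ∧ ‖a‖ < 1 / ((n : ℝ) + 1) := fun n =>
    h _ (by positivity)
  choose a haA haW ha0 han using this
  have hna : ∀ n, 0 < ‖a n‖ := fun n => norm_pos_iff.2 (ha0 n)
  have hlim : Tendsto (fun n => ‖a n‖) atTop (𝓝 0) :=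
    squeeze_zero (fun n => norm_nonneg _) (fun n => (han n).le)
      tendsto_one_div_add_atTop_nhds_zero_nat
  have hs : ∀ n, ‖a n‖⁻¹ • a n ∈ Metric.sphere (0 : E) 1 := fun n => by
    simp [norm_smul, (hna n).ne']
  obtain ⟨u, hu, φ, hφ, hlu⟩ := (isCompact_sphere (0 : E) 1).tendsto_subseq hs
  refine ⟨u, fun t => ?_, ?_, ?_⟩
  · have hfl : Tendsto (fun n => ((⌊t / ‖a (φ n)‖⌋ : ℝ) * ‖a (φ n)‖)) atTop (𝓝 t) := by
      have hl := hlim.comp hφ.tendsto_atTop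
      have h1 : Tendsto (fun n => t - ‖a (φ n)‖) atTop (𝓝 t) := by
        simpa using tendsto_const_nhds.sub hl
      refine tendsto_of_tendsto_of_tendsto_of_le_of_le h1 tendsto_const_nhds (fun n => ?_)
        (fun n => ?_)
      · have := Int.sub_one_lt_floor (t / ‖a (φ n)‖)
        have h2 := mul_le_mul_of_nonneg_right this.le (hna (φ n)).le
        rw [sub_mul, div_mul_cancel₀ _ (hna _).ne', one_mul] at h2
        exact h2
      · have := Int.floor_le (t / ‖a (φ n)‖)
        have h2 := mul_le_mul_of_nonneg_right this (hna (φ n)).le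
        rw [div_mul_cancel₀ _ (hna _).ne'] at h2
        exact h2
    refine hA.mem_of_tendsto (hfl.smul hlu) (Eventually.of_forall fun n => ?_)
    simp only [Function.comp, smul_smul]
    rw [mul_assoc, mul_inv_cancel₀ (hna _).ne', mul_one, Int.cast_smul_eq_zsmul]
    exact A.zsmul_mem (haA _) _
  · exact (Submodule.closed_of_finiteDimensional W).mem_of_tendsto hlu
      (Eventually.of_forall fun n => W.smul_mem _ (haW _))
  · rintro rfl
    simp at hu

/-- If L spans, a ℤ-basis of L is a real basis of W and any coordinate form works; otherwise a
nonzero form vanishes on L. -/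
theorem exists_linearMap_ne_zero_forall_int_of_discrete {W : Type*} [NormedAddCommGroup W]
    [NormedSpace ℝ W] [FiniteDimensional ℝ W] [Nontrivial W] (L : Submodule ℤ W)
    [DiscreteTopology L] :
    ∃ l : W →ₗ[ℝ] ℝ, l ≠ 0 ∧ ∀ a ∈ L, ∃ k : ℤ, l a = k := by
  by_cases h : Submodule.span ℝ (L : Set W) = ⊤
  · have : IsZLattice ℝ L := ⟨h⟩
    have : Module.Free ℤ L := ZLattice.module_free ℝ L
    let b := Module.Free.chooseBasis ℤ L
    let b' := b.ofZLatticeBasis ℝ L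
    obtain ⟨i⟩ : Nonempty (Module.Free.ChooseBasisIndex ℤ L) := b'.index_nonempty
    refine ⟨b'.coord i, fun h0 => ?_, fun a ha => ⟨b.repr ⟨a, ha⟩ i, ?_⟩⟩
    · have := LinearMap.congr_fun h0 (b' i)
      simp at this
    · exact b.ofZLatticeBasis_repr_apply ℝ L ⟨a, ha⟩ i
  · obtain ⟨l, hl, hl2⟩ := Submodule.exists_le_ker_of_lt_top _ (lt_top_iff_ne_top.2 h)
    exact ⟨l, hl, fun a ha => ⟨0, by simpa using hl2 (Submodule.subset_span ha)⟩⟩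

/-- A closed proper subgroup of a finite-dimensional real vector space is mapped into `ℤ` by some
nonzero linear form. -/
theorem AddSubgroup.exists_linearMap_ne_zero_forall_int {E : Type*}
    [NormedAddCommGroup E] [NormedSpace ℝ E] [FiniteDimensional ℝ E] {A : AddSubgroup E}
    (hA : IsClosed (A : Set E)) (hne : A ≠ ⊤) :
    ∃ l : E →ₗ[ℝ] ℝ, l ≠ 0 ∧ ∀ a ∈ A, ∃ k : ℤ, l a = k := by
  set V := A.maximalSubspace with hV
  obtain ⟨W, hW⟩ := Submodule.exists_isCompl V
  have hVA : ∀ v ∈ V, v ∈ A := fun v hv => by simpa using hv 1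
  -- Short nonzero vectors of A ∩ W would produce a line in V ∩ W = 0, so A ∩ W is discrete. Its
  -- form is then extended by zero on V ⊆ A.
  obtain ⟨ε, hε, hdisc⟩ : ∃ ε > 0, ∀ a ∈ A, a ∈ W → ‖a‖ < ε → a = 0 := by
    by_contra! hcon
    obtain ⟨u, hu, huW, hu0⟩ :=
      AddSubgroup.exists_mem_maximalSubspace_of_forall_exists_norm_lt hA W
        (fun ε hε => by
          obtain ⟨a, h1, h2, h3, h4⟩ := hcon ε hε
          exact ⟨a, h1, h2, h4, h3⟩)
    exact hu0 (Submodule.disjoint_def.1 hW.disjoint u hu huW)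
  have hWnt : Nontrivial W := by
    rw [Submodule.nontrivial_iff_ne_bot]
    rintro rfl
    apply hne
    have := hW.sup_eq_top
    rw [sup_bot_eq] at this
    exact eq_top_iff.2 fun x _ => hVA x (this ▸ Submodule.mem_top)
  let L : Submodule ℤ W := AddSubgroup.toIntSubmodule (A.comap W.subtype.toAddMonoidHom)
  have hL : ∀ w : W, w ∈ L ↔ (w : E) ∈ A := fun w => Iff.rfl
  have : DiscreteTopology L := by
    rw [discreteTopology_iff_isOpen_singleton_zero, Metric.isOpen_singleton_iff]
    refine ⟨ε, hε, fun y hy => ?_⟩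
    have := hdisc y y.2 y.1.2 (by simpa [dist_eq_norm] using hy)
    exact Subtype.ext (Subtype.ext this)
  obtain ⟨l, hl0, hl⟩ := exists_linearMap_ne_zero_forall_int_of_discrete L
  refine ⟨l ∘ₗ W.projectionOnto V hW.symm, fun h0 => hl0 ?_, fun a ha => ?_⟩
  · ext w
    have := LinearMap.congr_fun h0 (w : E)
    simpa using this
  · refine hl _ ((hL _).2 ?_)
    rw [Submodule.coe_projectionOnto_apply, Submodule.projection_eq_self_sub_projection hW]
    exact A.sub_mem ha (hVA _ (Submodule.projection_apply_mem _ a))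

/-! ### Mal'cev coordinates on the abelianization -/

/-- No commutation is needed: all nontrivial a's stand strictly before all nontrivial b's, so both
sides list the same factors in the same order. -/
theorem List.prod_ofFn_mul_prod_ofFn_of_separated {M : Type*} [Monoid M] :
    ∀ {n : ℕ} (a b : Fin n → M), (∀ i j, i ≤ j → b i ≠ 1 → a j = 1) →
      (List.ofFn a).prod * (List.ofFn b).prod = (List.ofFn fun i => a i * b i).prod
  | 0, a, b, _ => by simp
  | n + 1, a, b, h => by
    simp only [List.ofFn_succ, List.prod_cons]
    by_cases hb : b 0 = 1
    · rw [← List.prod_ofFn_mul_prod_ofFn_of_separated (fun i => a i.succ) (fun i => b i.succ)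
        (fun i j hij => h i.succ j.succ (Fin.succ_le_succ_iff.2 hij)), hb, one_mul, mul_one,
        mul_assoc]
    · have ha : ∀ j, a j = 1 := fun j => h 0 j (Fin.zero_le j) hb
      simp [ha]

theorem inv_mul_mem_lowerCentralSeries_one_iff {N : Type*} [Group N] {x y : N} :
    x⁻¹ * y ∈ (⊤ : Subgroup N).lowerCentralSeries 1 ↔ Abelianization.of x = Abelianization.of y :=
  QuotientGroup.eq.symm

namespace MalcevBasis

variable {N : Type*} [Group N] [TopologicalSpace N] {Λ : Subgroup N} (B : MalcevBasis N Λ)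

/-- The element `e₁ ^ t₁ ⋯ e_k ^ t_k`. -/
def coordProd (t : Fin B.dim → ℝ) : N :=
  (List.ofFn fun j => B.oneParam j (Multiplicative.ofAdd (t j))).prod

/-- The indices of the basis elements that project to a basis of the abelianization. -/
abbrev ZeroIdx : Type := {j : Fin B.dim // B.level j = 0}

/-- Extension by zero of level-zero coordinates. -/
def extend (s : B.ZeroIdx → ℝ) : Fin B.dim → ℝ :=
  fun j => if h : B.level j = 0 then s ⟨j, h⟩ else 0

theorem oneParam_zero (j : Fin B.dim) : B.oneParam j (Multiplicative.ofAdd (0 : ℝ)) = 1 :=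
  map_one (B.oneParam j)

theorem oneParam_add (j : Fin B.dim) (s t : ℝ) :
    B.oneParam j (Multiplicative.ofAdd (s + t)) =
      B.oneParam j (Multiplicative.ofAdd s) * B.oneParam j (Multiplicative.ofAdd t) :=
  map_mul (B.oneParam j) (Multiplicative.ofAdd s) (Multiplicative.ofAdd t)

theorem continuous_oneParam (j : Fin B.dim) :
    Continuous fun t : ℝ => B.oneParam j (Multiplicative.ofAdd t) :=
  (map_continuous (B.oneParam j)).comp continuous_ofAdd

theorem continuous_coordProd [ContinuousMul N] : Continuous B.coordProd := by
  have := continuous_list_prod (X := Fin B.dim → ℝ)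
    (f := fun j t => B.oneParam j (Multiplicative.ofAdd (t j))) (List.finRange B.dim)
    (fun j _ => (B.continuous_oneParam j).comp (continuous_apply j))
  refine this.congr fun t => ?_
  rw [coordProd, List.ofFn_eq_map]

theorem continuous_extend : Continuous B.extend := by
  refine continuous_pi fun j => ?_
  by_cases h : B.level j = 0
  · simpa [extend, h] using continuous_apply _
  · simpa [extend, h] using continuous_const

theorem coordProd_zero : B.coordProd 0 = 1 := by
  rw [coordProd, List.ofFn_eq_map]
  exact List.prod_eq_one fun x hx => by
    obtain ⟨j, -, rfl⟩ := List.mem_map.1 hx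
    exact B.oneParam_zero j

theorem extend_zero : B.extend 0 = 0 := by
  ext j; simp [extend]

theorem extend_add (s t : B.ZeroIdx → ℝ) : B.extend (s + t) = B.extend s + B.extend t := by
  ext j; by_cases h : B.level j = 0 <;> simp [extend, h]

theorem of_coordProd (t : Fin B.dim → ℝ) : Abelianization.of (B.coordProd t) =
    ∏ j, Abelianization.of (B.oneParam j (Multiplicative.ofAdd (t j))) := by
  rw [coordProd, map_list_prod, List.map_ofFn, List.prod_ofFn]
  rfl

theorem of_coordProd_add (s t : Fin B.dim → ℝ) : Abelianization.of (B.coordProd (s + t)) =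
    Abelianization.of (B.coordProd s) * Abelianization.of (B.coordProd t) := by
  simp only [of_coordProd, ← Finset.prod_mul_distrib, Pi.add_apply, oneParam_add, map_mul]

theorem of_coordProd_extend (t : Fin B.dim → ℝ) :
    Abelianization.of (B.coordProd (B.extend fun j => t j)) =
      Abelianization.of (B.coordProd t) := by
  rw [of_coordProd, of_coordProd]
  refine Finset.prod_congr rfl fun j _ => ?_
  by_cases h : B.level j = 0
  · simp [extend, h]
  · have hm : ∀ t, Abelianization.of (B.oneParam j (Multiplicative.ofAdd t)) = 1 := fun t =>
      (QuotientGroup.eq_one_iff _).2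
        (Subgroup.lowerCentralSeries_antitone _ (Nat.one_le_iff_ne_zero.2 h)
          (B.mem_lowerCentralSeries j t))
    rw [hm, hm]

theorem existsUnique_level_zero (x : N) :
    ∃! s : B.ZeroIdx → ℝ, Abelianization.of x = Abelianization.of (B.coordProd (B.extend s)) := by
  obtain ⟨t, ⟨ht0, ht⟩, huniq⟩ := B.existsUnique_of_level 0 x (Subgroup.mem_top x)
  refine ⟨fun j => t j, ?_, fun s hs => ?_⟩
  · change Abelianization.of x = Abelianization.of (B.coordProd (B.extend fun j => t j))
    rw [B.of_coordProd_extend]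
    exact inv_mul_mem_lowerCentralSeries_one_iff.1 ht
  · have := huniq (B.extend s) ⟨fun j hj => by simp [extend, hj],
      inv_mul_mem_lowerCentralSeries_one_iff.2 hs⟩
    ext j
    rw [← this]
    simp [extend, j.2]

/-- The coordinates of the image of `x` in the abelianization. -/
noncomputable def theta (x : N) : B.ZeroIdx → ℝ := (B.existsUnique_level_zero x).choose

theorem of_coordProd_theta (x : N) :
    Abelianization.of (B.coordProd (B.extend (B.theta x))) = Abelianization.of x :=
  (B.existsUnique_level_zero x).choose_spec.1.symm

theorem theta_eq {x : N} {s : B.ZeroIdx → ℝ}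
    (h : Abelianization.of (B.coordProd (B.extend s)) = Abelianization.of x) : B.theta x = s :=
  (B.existsUnique_level_zero x).unique (B.of_coordProd_theta x).symm h.symm

theorem theta_coordProd (t : Fin B.dim → ℝ) : B.theta (B.coordProd t) = fun j : B.ZeroIdx => t j :=
  B.theta_eq (B.of_coordProd_extend t)

theorem theta_coordProd_extend (s : B.ZeroIdx → ℝ) : B.theta (B.coordProd (B.extend s)) = s :=
  B.theta_eq rfl

theorem theta_mul (x y : N) : B.theta (x * y) = B.theta x + B.theta y := by
  apply B.theta_eq
  rw [extend_add, of_coordProd_add, of_coordProd_theta, of_coordProd_theta, map_mul]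

theorem theta_one : B.theta 1 = 0 := by
  simpa using B.theta_mul 1 1

theorem theta_inv (x : N) : B.theta x⁻¹ = -B.theta x := by
  rw [eq_neg_iff_add_eq_zero, ← theta_mul, inv_mul_cancel, theta_one]

theorem theta_eq_theta_iff {x y : N} :
    B.theta x = B.theta y ↔ x⁻¹ * y ∈ (⊤ : Subgroup N).lowerCentralSeries 1 := by
  rw [inv_mul_mem_lowerCentralSeries_one_iff]
  refine ⟨fun h => ?_, fun h => ?_⟩
  · rw [← B.of_coordProd_theta x, h, B.of_coordProd_theta]
  · exact B.theta_eq (by rw [B.of_coordProd_theta, h])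

theorem coordProd_mul_coordProd {i : ℕ} {s t : Fin B.dim → ℝ} (hs : ∀ j, i ≤ B.level j → s j = 0)
    (ht : ∀ j, B.level j ≠ i → t j = 0) :
    B.coordProd s * B.coordProd t = B.coordProd (s + t) := by
  simp only [coordProd, Pi.add_apply, oneParam_add]
  refine List.prod_ofFn_mul_prod_ofFn_of_separated _ _ fun j k hjk hj => ?_
  have hji : B.level j = i := by
    by_contra hne
    exact hj (by rw [ht j hne, oneParam_zero])
  rw [hs k (hji ▸ B.level_mono hjk), oneParam_zero]

/-- Coordinates are found level by level. Those of level i are appended on the right, which respects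
the order of the product because the basis is sorted by level. -/
theorem exists_eq_coordProd_mul (i : ℕ) (x : N) :
    ∃ t : Fin B.dim → ℝ, (∀ j, i ≤ B.level j → t j = 0) ∧
      ∃ y ∈ (⊤ : Subgroup N).lowerCentralSeries i, x = B.coordProd t * y := by
  induction i with
  | zero => exact ⟨0, fun _ _ => rfl, x, Subgroup.mem_top _, by rw [coordProd_zero, one_mul]⟩
  | succ i ih =>
    obtain ⟨s, hs, y, hy, rfl⟩ := ih
    obtain ⟨t, ⟨ht0, ht⟩, -⟩ := B.existsUnique_of_level i y hy
    refine ⟨s + t, fun j hj => ?_, (y⁻¹ * B.coordProd t)⁻¹, Subgroup.inv_mem _ ht, ?_⟩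
    · rw [Pi.add_apply, hs j (by omega), ht0 j (by omega), add_zero]
    · rw [← B.coordProd_mul_coordProd hs ht0]
      group

theorem coordProd_surjective [Group.IsNilpotent N] : Function.Surjective B.coordProd := by
  intro x
  obtain ⟨n, hn⟩ := Subgroup.nilpotent_iff_lowerCentralSeries.1 ‹Group.IsNilpotent N›
  obtain ⟨t, -, y, hy, rfl⟩ := B.exists_eq_coordProd_mul n x
  rw [hn, Subgroup.mem_bot] at hy
  exact ⟨t, by rw [hy, mul_one]⟩

theorem theta_int_of_mem [Group.IsNilpotent N] {x : N} (hx : x ∈ Λ) (j : B.ZeroIdx) :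
    ∃ m : ℤ, B.theta x j = m := by
  obtain ⟨t, rfl⟩ := B.coordProd_surjective x
  rw [B.theta_coordProd]
  exact (B.mem_lattice_iff t).1 hx j

/-- By Baire, one of the compact sets `coordProd '' closedBall 0 n` has an interior point. On it θ
is continuous, since preimages of closed sets are images of compact sets of coordinates. A
homomorphism continuous at one point is continuous everywhere. -/
theorem continuous_theta [IsTopologicalGroup N] [LocallyCompactSpace N] [T2Space N]
    [Group.IsNilpotent N] : Continuous B.theta := by
  have hcomp : ∀ n : ℕ, IsCompact (Metric.closedBall (0 : Fin B.dim → ℝ) n) := fun n =>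
    isCompact_closedBall _ _
  obtain ⟨n, x₀, hx₀⟩ := nonempty_interior_of_iUnion_of_closed
    (f := fun n : ℕ => B.coordProd '' Metric.closedBall (0 : Fin B.dim → ℝ) n)
    (fun n => ((hcomp n).image B.continuous_coordProd).isClosed)
    (Set.eq_univ_of_forall fun x => by
      obtain ⟨t, rfl⟩ := B.coordProd_surjective x
      obtain ⟨n, hn⟩ := exists_nat_ge ‖t‖
      exact Set.mem_iUnion.2 ⟨n, t, by simpa using hn, rfl⟩)
  have hon : ContinuousOn B.theta (B.coordProd '' Metric.closedBall (0 : Fin B.dim → ℝ) n) := by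
    rw [continuousOn_iff_isClosed]
    intro F hF
    have hc : IsClosed ((fun (t : Fin B.dim → ℝ) (j : B.ZeroIdx) => t j) ⁻¹' F) :=
      hF.preimage (by fun_prop)
    refine ⟨B.coordProd '' (Metric.closedBall 0 n ∩
      (fun (t : Fin B.dim → ℝ) (j : B.ZeroIdx) => t j) ⁻¹' F),
      (((hcomp n).inter_right hc).image B.continuous_coordProd).isClosed, ?_⟩
    ext x
    constructor
    · rintro ⟨hx, t, ht, rfl⟩
      refine ⟨⟨t, ⟨ht, ?_⟩, rfl⟩, t, ht, rfl⟩
      rwa [Set.mem_preimage, B.theta_coordProd] at hx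
    · rintro ⟨⟨t, ⟨ht, htF⟩, rfl⟩, hx⟩
      refine ⟨?_, hx⟩
      rwa [Set.mem_preimage, B.theta_coordProd]
  have hat : ContinuousAt B.theta x₀ := hon.continuousAt (mem_interior_iff_mem_nhds.1 hx₀)
  rw [continuous_iff_continuousAt]
  intro x
  have heq : B.theta = fun y => B.theta (y * x⁻¹ * x₀) - B.theta (x⁻¹ * x₀) := by
    ext1 y
    rw [mul_assoc, theta_mul, add_sub_cancel_right]
  rw [heq]
  refine ContinuousAt.sub (ContinuousAt.comp (g := B.theta) ?_ (by fun_prop)) continuousAt_const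
  simpa using hat

end MalcevBasis

/-! ### From a real linear relation to an integral one -/

theorem exists_pos_forall_mem_mul_eq_intCast (s : Finset ℚ) :
    ∃ D : ℤ, 0 < D ∧ ∀ x ∈ s, ∃ k : ℤ, (D : ℚ) * x = k := by
  refine ⟨∏ x ∈ s, (x.den : ℤ), Finset.prod_pos fun x _ => by exact_mod_cast x.den_pos,
    fun x hx => ?_⟩
  obtain ⟨a, ha⟩ := Finset.dvd_prod_of_mem (fun x : ℚ => (x.den : ℤ)) hx
  refine ⟨a * x.num, ?_⟩
  rw [ha]
  push_cast
  rw [mul_comm (x.den : ℚ), mul_assoc, mul_comm (x.den : ℚ), Rat.mul_den_eq_num]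

theorem Polynomial.exists_int_multiple (p : Polynomial ℚ) :
    ∃ D : ℤ, 0 < D ∧ ∃ p₀ : Polynomial ℤ, p₀.map (Int.castRingHom ℚ) = Polynomial.C (D : ℚ) * p := by
  obtain ⟨D, hD, h⟩ := exists_pos_forall_mem_mul_eq_intCast
    ((Finset.range (p.natDegree + 1)).image p.coeff)
  refine ⟨D, hD, ?_⟩
  suffices Polynomial.C (D : ℚ) * p ∈ Polynomial.lifts (Int.castRingHom ℚ) by
    obtain ⟨q, hq⟩ := (Polynomial.mem_lifts _).1 this
    exact ⟨q, hq⟩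
  rw [Polynomial.lifts_iff_coeff_lifts]
  intro n
  rw [Polynomial.coeff_C_mul]
  by_cases hn : n ∈ Finset.range (p.natDegree + 1)
  · obtain ⟨k, hk⟩ := h (p.coeff n) (Finset.mem_image.2 ⟨n, hn, rfl⟩)
    exact ⟨k, by simpa using hk.symm⟩
  · rw [Polynomial.coeff_eq_zero_of_natDegree_lt (by rw [Finset.mem_range] at hn; omega)]
    exact ⟨0, by simp⟩

theorem Polynomial.eq_C_of_abs_eval_le {S : Polynomial ℝ} {K : ℝ} {I : Set ℤ} (hI : I.Infinite)
    (h : ∀ n ∈ I, |S.eval (n : ℝ)| ≤ K) : ∃ s, S = Polynomial.C s := by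
  by_contra hcon
  have hdeg : 0 < S.degree := by
    by_contra hle
    exact hcon ⟨_, Polynomial.eq_C_of_degree_le_zero (not_lt.1 hle)⟩
  have ht : Tendsto (fun n : ℤ => ‖S.eval (n : ℝ)‖) cofinite atTop := by
    refine S.tendsto_norm_atTop hdeg ?_
    exact tendsto_norm_cocompact_atTop.comp Int.tendsto_coe_cofinite
  have hev := ht.eventually_gt_atTop K
  rw [eventually_cofinite] at hev
  refine hI (hev.subset fun n hn => ?_)
  simpa using h n hn

/-- If a real linear form of bounded fractional parts of real polynomials takes a constant value
infinitely often, then a nontrivial integral combination of the polynomials is constant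
modulo `1`. -/
theorem exists_int_combination_eq_const {J : Type*} [Fintype J] {l : J → ℝ} (hl : ∃ j, l j ≠ 0)
    (p : J → Polynomial ℝ) (c K : ℝ) {I : Set ℤ} (hI : I.Infinite)
    (h : ∀ n ∈ I, ∃ z : J → ℤ, ∑ j, l j * z j = ∑ j, l j * (p j).eval (n : ℝ) - c ∧
      ∀ j, |(p j).eval (n : ℝ) - z j| ≤ K) :
    ∃ ξ : J → ℤ, ξ ≠ 0 ∧ ∃ c₁ : ℝ, ∀ n : ℤ, ∃ k : ℤ,
      ∑ j, ξ j * (p j).eval (n : ℝ) = k + c₁ := by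
  obtain ⟨j₀, hj₀⟩ := hl
  -- A ℚ-linear φ : ℝ → ℚ replaces the real coefficients l j by rational ones, not all zero, and
  -- commutes with multiplication by the integers z j.
  obtain ⟨φ, hφ⟩ : ∃ φ : Module.Dual ℚ ℝ, φ (l j₀) ≠ 0 := by
    by_contra! hcon
    exact hj₀ ((Module.forall_dual_apply_eq_zero_iff ℚ _).1 hcon)
  set R : Polynomial ℝ := ∑ j, Polynomial.C (l j) * p j - Polynomial.C c with hR
  -- Applying φ coefficientwise is compatible with evaluation at integers, where only ℚ-linearity is
  -- involved.
  let Q : Polynomial ℚ := ∑ i ∈ Finset.range (R.natDegree + 1), Polynomial.monomial i (φ (R.coeff i))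
  have hQ : ∀ n : ℤ, Q.eval (n : ℚ) = φ (R.eval (n : ℝ)) := by
    intro n
    rw [Polynomial.eval_eq_sum_range (p := R), map_sum, Polynomial.eval_finsetSum]
    refine Finset.sum_congr rfl fun i _ => ?_
    rw [Polynomial.eval_monomial, mul_comm (R.coeff i), ← Int.cast_pow, ← Int.cast_pow,
      ← zsmul_eq_mul, map_zsmul, zsmul_eq_mul, mul_comm]
  set S : Polynomial ℝ := ∑ j, Polynomial.C ((φ (l j) : ℚ) : ℝ) * p j -
    Q.map (algebraMap ℚ ℝ) with hS
  have hQmap : ∀ n : ℤ, (Q.map (algebraMap ℚ ℝ)).eval (n : ℝ) = ((Q.eval (n : ℚ) : ℚ) : ℝ) := by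
    intro n
    have := Polynomial.eval_map_algebraMap Q (n : ℝ)
    rw [this]
    have h2 := Polynomial.aeval_algebraMap_apply ℝ (n : ℚ) Q
    simpa using h2
  -- For n ∈ I the value S(n) is ∑ φ(l j) (p j(n) - z j), which is bounded; a polynomial bounded at
  -- infinitely many integers is constant.
  obtain ⟨s, hs⟩ : ∃ s, S = Polynomial.C s := by
    refine Polynomial.eq_C_of_abs_eval_le (K := ∑ j, |((φ (l j) : ℚ) : ℝ)| * K) hI fun n hn => ?_
    obtain ⟨z, hz, hzb⟩ := h n hn
    have h1 : Q.eval (n : ℚ) = ∑ j, φ (l j) * z j := by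
      rw [hQ]
      have : R.eval (n : ℝ) = ∑ j, l j * z j := by
        rw [hz, hR]
        simp [Polynomial.eval_finsetSum]
      rw [this, map_sum]
      refine Finset.sum_congr rfl fun j _ => ?_
      rw [mul_comm, ← zsmul_eq_mul, map_zsmul, zsmul_eq_mul, mul_comm]
    have h2 : S.eval (n : ℝ) = ∑ j, ((φ (l j) : ℚ) : ℝ) * ((p j).eval (n : ℝ) - z j) := by
      rw [hS, Polynomial.eval_sub, hQmap, h1]
      simp [Polynomial.eval_finsetSum, mul_sub, Finset.sum_sub_distrib]
    rw [h2]
    refine (Finset.abs_sum_le_sum_abs _ _).trans (Finset.sum_le_sum fun j _ => ?_)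
    rw [abs_mul]
    exact mul_le_mul_of_nonneg_left (hzb j) (abs_nonneg _)
  obtain ⟨D₁, hD₁, Q₀, hQ₀⟩ := Q.exists_int_multiple
  obtain ⟨D₂, hD₂, hξ⟩ := exists_pos_forall_mem_mul_eq_intCast
    (Finset.univ.image fun j => φ (l j))
  have hξ' : ∀ j, ∃ k : ℤ, (D₂ : ℚ) * φ (l j) = k := fun j =>
    hξ _ (Finset.mem_image_of_mem _ (Finset.mem_univ j))
  choose ζ hζ using hξ'
  -- D₁ clears the denominators of Q and D₂ those of the φ(l j), so ξ j = D₁ D₂ φ(l j). Multiplying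
  -- S = s by D₁ D₂ leaves the integer D₂ Q₀(n) and the constant D₁ D₂ s.
  refine ⟨fun j => D₁ * ζ j, fun h0 => ?_, D₁ * D₂ * s, fun n => ⟨D₂ * Q₀.eval n, ?_⟩⟩
  · have h1 := congrFun h0 j₀
    have h2 : ζ j₀ = 0 := by simpa [hD₁.ne'] using h1
    have h3 := hζ j₀
    rw [h2] at h3
    simp [hD₂.ne', hφ] at h3
  · have h1 : ((Q₀.eval n : ℤ) : ℚ) = D₁ * Q.eval (n : ℚ) := by
      have := congrArg (Polynomial.eval (n : ℚ)) hQ₀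
      rw [Polynomial.eval_mul, Polynomial.eval_C] at this
      rw [← this, Polynomial.eval_intCast_map]
      rfl
    have h1' : ((Q₀.eval n : ℤ) : ℝ) = D₁ * ((Q.eval (n : ℚ) : ℚ) : ℝ) := by
      exact_mod_cast congrArg (Rat.cast (K := ℝ)) h1
    have h2 := congrArg (Polynomial.eval (n : ℝ)) hs
    rw [hS, Polynomial.eval_sub, hQmap, Polynomial.eval_C, Polynomial.eval_finsetSum] at h2
    have h3 : ∀ j, (ζ j : ℝ) = D₂ * ((φ (l j) : ℚ) : ℝ) := fun j => by
      exact_mod_cast congrArg (Rat.cast (K := ℝ)) (hζ j).symm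
    push_cast
    rw [h1', ← h2]
    simp only [h3, Polynomial.eval_mul, Polynomial.eval_C, mul_sub, Finset.mul_sum]
    have : ∀ j, (D₁ : ℝ) * (D₂ * ((φ (l j) : ℚ) : ℝ)) * (p j).eval (n : ℝ) =
      D₁ * D₂ * (((φ (l j) : ℚ) : ℝ) * (p j).eval (n : ℝ)) := fun j => by ring
    simp only [this]
    ring

/-! ### Integer-valued polynomials and polynomial maps into abelian groups -/

/-- An integer-valued polynomial function on `ℤ`. -/
def IsIntPoly (P : ℤ → ℤ) : Prop := ∃ p : Polynomial ℚ, ∀ n : ℤ, (P n : ℚ) = p.eval (n : ℚ)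

theorem isIntPoly_const (a : ℤ) : IsIntPoly fun _ => a := ⟨Polynomial.C (a : ℚ), by simp⟩

theorem IsIntPoly.mul {P Q : ℤ → ℤ} (hP : IsIntPoly P) (hQ : IsIntPoly Q) :
    IsIntPoly fun n => P n * Q n := by
  obtain ⟨p, hp⟩ := hP
  obtain ⟨q, hq⟩ := hQ
  exact ⟨p * q, fun n => by simp [hp, hq]⟩

theorem IsIntPoly.comp {P Q : ℤ → ℤ} (hP : IsIntPoly P) (hQ : IsIntPoly Q) :
    IsIntPoly fun n => P (Q n) := by
  obtain ⟨p, hp⟩ := hP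
  obtain ⟨q, hq⟩ := hQ
  exact ⟨p.comp q, fun n => by simp [hp, hq]⟩

theorem isIntPoly_choose (r : ℕ) : IsIntPoly fun n => Ring.choose n r := by
  refine ⟨Polynomial.C ((r.factorial : ℚ)⁻¹) * (descPochhammer ℤ r).map (Int.castRingHom ℚ),
    fun n => ?_⟩
  have h1 : ((Ring.choose n r : ℤ) : ℚ) = Ring.choose (n : ℚ) r :=
    Ring.map_choose (Int.castRingHom ℚ) n r
  rw [h1, Ring.choose_eq_smul, Polynomial.eval_mul, Polynomial.eval_C, smul_eq_mul,
    Polynomial.eval_map, ← Polynomial.eval₂_smulOneHom_eq_smeval]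
  congr 2
  exact RingHom.ext_int _ _

/-- If D P has integer coefficients, then D e ∣ q' forces D e ∣ D (P(r + q' n) - P(r)), and D
cancels. -/
theorem IsIntPoly.exists_periodic {P : ℤ → ℤ} (hP : IsIntPoly P) {e : ℤ} (he : 0 < e) :
    ∃ q : ℤ, 0 < q ∧ ∀ q', q ∣ q' → ∀ r, ∃ P' : ℤ → ℤ, IsIntPoly P' ∧
      ∀ n, P (r + q' * n) = P r + e * P' n := by
  obtain ⟨p, hp⟩ := hP
  obtain ⟨D, hD, p₀, hp₀⟩ := p.exists_int_multiple
  have hDP : ∀ n, D * P n = p₀.eval n := by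
    intro n
    have := congrArg (Polynomial.eval (n : ℚ)) hp₀
    rw [Polynomial.eval_mul, Polynomial.eval_C, ← hp] at this
    have h2 : ((p₀.eval n : ℤ) : ℚ) = D * P n := by
      rw [← this, Polynomial.eval_intCast_map]
      rfl
    exact_mod_cast h2.symm
  refine ⟨D * e, mul_pos hD he, fun q' hq' r => ?_⟩
  have hdvd : ∀ n, e ∣ P (r + q' * n) - P r := by
    intro n
    have h1 := Polynomial.sub_dvd_eval_sub (r + q' * n) r p₀
    rw [add_sub_cancel_left, ← hDP, ← hDP, ← mul_sub] at h1
    exact Int.dvd_of_mul_dvd_mul_left hD.ne' ((hq'.mul_right n).trans h1)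
  choose P' hP' using hdvd
  refine ⟨P', ⟨Polynomial.C ((e : ℚ)⁻¹) * (p.comp (Polynomial.C (r : ℚ) +
    Polynomial.C (q' : ℚ) * Polynomial.X) - Polynomial.C (P r : ℚ)), fun n => ?_⟩,
    fun n => by rw [← hP' n]; ring⟩
  have he' : (e : ℚ) ≠ 0 := by exact_mod_cast he.ne'
  have h1 : (P (r + q' * n) : ℚ) - P r = e * P' n := by exact_mod_cast hP' n
  have h2 := hp (r + q' * n)
  push_cast at h2
  simp only [Polynomial.eval_mul, Polynomial.eval_C, Polynomial.eval_sub, Polynomial.eval_comp,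
    Polynomial.eval_add, Polynomial.eval_X]
  rw [← h2, h1, inv_mul_cancel_left₀ he']

/-- Polynomial maps from `ℤ` to an abelian group with coefficients in a given subgroup. -/
def polyMaps {A : Type*} [AddCommGroup A] (S : AddSubgroup A) : AddSubgroup (ℤ → A) :=
  AddSubgroup.closure {φ | ∃ P : ℤ → ℤ, IsIntPoly P ∧ ∃ a ∈ S, φ = fun n => P n • a}

theorem smul_const_mem_polyMaps {A : Type*} [AddCommGroup A] {S : AddSubgroup A} {P : ℤ → ℤ}
    (hP : IsIntPoly P) {a : A} (ha : a ∈ S) : (fun n => P n • a) ∈ polyMaps S :=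
  AddSubgroup.subset_closure ⟨P, hP, a, ha, rfl⟩

theorem smul_mem_polyMaps {A : Type*} [AddCommGroup A] {S : AddSubgroup A} {P : ℤ → ℤ}
    (hP : IsIntPoly P) {φ : ℤ → A} (hφ : φ ∈ polyMaps S) : (fun n => P n • φ n) ∈ polyMaps S := by
  induction hφ using AddSubgroup.closure_induction with
  | mem φ h =>
    obtain ⟨Q, hQ, a, ha, rfl⟩ := h
    simpa only [smul_smul] using smul_const_mem_polyMaps (hP.mul hQ) ha
  | zero =>
    simp only [Pi.zero_apply, smul_zero]
    exact (polyMaps S).zero_mem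
  | add φ ψ _ _ h1 h2 =>
    have := (polyMaps S).add_mem h1 h2
    refine (congrArg (· ∈ polyMaps S) ?_).mp this
    ext n; simp
  | neg φ _ h1 =>
    have := (polyMaps S).neg_mem h1
    refine (congrArg (· ∈ polyMaps S) ?_).mp this
    ext n; simp

theorem apply_mem_polyMaps {A B : Type*} [AddCommGroup A] [AddCommGroup B] {S : AddSubgroup A}
    {S' : AddSubgroup B} {T : ℤ → A →+ B} (hT : ∀ a ∈ S, (fun n => T n a) ∈ polyMaps S')
    {φ : ℤ → A} (hφ : φ ∈ polyMaps S) : (fun n => T n (φ n)) ∈ polyMaps S' := by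
  induction hφ using AddSubgroup.closure_induction with
  | mem φ h =>
    obtain ⟨Q, hQ, a, ha, rfl⟩ := h
    simpa only [map_zsmul] using smul_mem_polyMaps hQ (hT a ha)
  | zero =>
    simp only [Pi.zero_apply, map_zero]
    exact (polyMaps S').zero_mem
  | add φ ψ _ _ h1 h2 =>
    have := (polyMaps S').add_mem h1 h2
    refine (congrArg (· ∈ polyMaps S') ?_).mp this
    ext n; simp
  | neg φ _ h1 =>
    have := (polyMaps S').neg_mem h1
    refine (congrArg (· ∈ polyMaps S') ?_).mp this
    ext n; simp

theorem exists_polynomial_of_mem_polyMaps {S : AddSubgroup UnitAddCircle} {φ : ℤ → UnitAddCircle}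
    (hφ : φ ∈ polyMaps S) :
    ∃ p : Polynomial ℝ, ∀ n : ℤ, φ n = ((p.eval (n : ℝ) : ℝ) : UnitAddCircle) := by
  induction hφ using AddSubgroup.closure_induction with
  | mem φ h =>
    obtain ⟨Q, ⟨q, hq⟩, a, ha, rfl⟩ := h
    obtain ⟨α, rfl⟩ := QuotientAddGroup.mk_surjective a
    refine ⟨q.map (algebraMap ℚ ℝ) * Polynomial.C α, fun n => ?_⟩
    have h1 : (q.map (algebraMap ℚ ℝ)).eval (n : ℝ) = Q n := by
      have h2 := Polynomial.aeval_algebraMap_apply ℝ (n : ℚ) q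
      rw [Polynomial.eval_map_algebraMap]
      rw [Polynomial.coe_aeval_eq_eval, ← hq] at h2
      simpa using h2
    rw [Polynomial.eval_mul, h1, Polynomial.eval_C, ← zsmul_eq_mul]
    rfl
  | zero => exact ⟨0, by simp⟩
  | add φ ψ _ _ h1 h2 =>
    obtain ⟨p, hp⟩ := h1
    obtain ⟨q, hq⟩ := h2
    exact ⟨p + q, fun n => by simp [hp, hq]⟩
  | neg φ _ h1 =>
    obtain ⟨p, hp⟩ := h1
    exact ⟨-p, fun n => by simp [hp]⟩

/-! ### Functions killed by repeated differences, and translation by polynomial sequences -/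

section Translation

variable {G B : Type*} [Group G] [AddCommGroup B]

/-- Left translation of functions on a group. -/
def leftTranslate (x : G) : (G → B) →+ (G → B) where
  toFun f := fun y => f (x * y)
  map_zero' := rfl
  map_add' _ _ := rfl

theorem leftTranslate_apply (x : G) (f : G → B) (y : G) : leftTranslate x f y = f (x * y) := rfl

theorem leftTranslate_mul (x y : G) (f : G → B) : leftTranslate (x * y) f = leftTranslate y (leftTranslate x f) := by
  ext z; simp [leftTranslate_apply, mul_assoc]

theorem leftTranslate_one (f : G → B) : leftTranslate 1 f = f := by
  ext z; simp [leftTranslate_apply]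

variable (B) in
/-- Functions on `G` annihilated by any `k` difference operators with steps in `K`. -/
def unipotentFunctions (K : Subgroup G) : ℕ → AddSubgroup (G → B)
  | 0 => ⊥
  | k + 1 =>
    { carrier := {f | ∀ h ∈ K, leftTranslate h f - f ∈ unipotentFunctions K k}
      zero_mem' := fun h _ => by simp
      add_mem' := fun {f f'} hf hf' h hh => by
        rw [map_add, add_sub_add_comm]
        exact AddSubgroup.add_mem _ (hf h hh) (hf' h hh)
      neg_mem' := fun {f} hf h hh => by
        rw [map_neg, neg_sub_neg, ← neg_sub]
        exact AddSubgroup.neg_mem _ (hf h hh) }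

theorem unipotentFunctions_mono (K : Subgroup G) : Monotone (unipotentFunctions B K) := by
  refine monotone_nat_of_le_succ fun k => ?_
  induction k with
  | zero => exact bot_le
  | succ k ih => exact fun f hf h hh => ih (hf h hh)

theorem leftTranslate_mem_unipotentFunctions {K : Subgroup G} [hK : K.Normal] {k : ℕ} (x : G)
    {f : G → B} (hf : f ∈ unipotentFunctions B K k) :
    leftTranslate x f ∈ unipotentFunctions B K k := by
  induction k generalizing f with
  | zero =>
    rw [unipotentFunctions, AddSubgroup.mem_bot] at hf
    rw [hf, map_zero]
    exact AddSubgroup.zero_mem _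
  | succ k ih =>
    intro h hh
    have h1 := ih (hf _ (hK.conj_mem h hh x))
    rwa [map_sub, ← leftTranslate_mul, inv_mul_cancel_right, leftTranslate_mul] at h1

theorem sum_choose_succ_smul {A : Type*} [AddCommGroup A] (a : ℕ → A) (m : ℤ) (k : ℕ) :
    ∑ r ∈ Finset.range (k + 1), Ring.choose (m + 1) r • a r =
      ∑ r ∈ Finset.range (k + 1), Ring.choose m r • a r +
        ∑ r ∈ Finset.range k, Ring.choose m r • a (r + 1) := by
  induction k with
  | zero => simp
  | succ k ih =>
    rw [Finset.sum_range_succ, ih, Finset.sum_range_succ _ (k + 1),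
      Finset.sum_range_succ (fun r => Ring.choose m r • a (r + 1)) k, Ring.choose_succ_succ, add_smul]
    abel

/-- Newton's binomial expansion of (1 + Δ)^m, where Δ is the difference operator with step h; it
terminates because Δ^k f = 0. Both sides agree at m = 0 and satisfy the same recursion, which is
invertible and so also reaches negative m. -/
theorem leftTranslate_zpow_eq_sum {K : Subgroup G} {k : ℕ} {h : G} (hh : h ∈ K)
    {f : G → B} (hf : f ∈ unipotentFunctions B K k) (m : ℤ) :
    leftTranslate (h ^ m) f = ∑ r ∈ Finset.range (k + 1),
      Ring.choose m r • ((fun f : G → B => leftTranslate h f - f)^[r] f) := by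
  set a : ℕ → G → B := fun r => (fun f : G → B => leftTranslate h f - f)^[r] f with ha
  have hsucc : ∀ r, a (r + 1) = leftTranslate h (a r) - a r := fun r =>
    Function.iterate_succ_apply' _ _ _
  have hmem : ∀ r ≤ k, a r ∈ unipotentFunctions B K (k - r) := by
    intro r
    induction r with
    | zero => intro _; exact hf
    | succ r ih =>
      intro hr
      rw [hsucc]
      have h1 := ih (by omega)
      rw [show k - r = k - (r + 1) + 1 by omega] at h1
      exact h1 h hh
  have hk0 : a k = 0 := by
    have := hmem k le_rfl
    rwa [Nat.sub_self, unipotentFunctions, AddSubgroup.mem_bot] at this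
  have hk1 : a (k + 1) = 0 := by rw [hsucc, hk0]; simp
  set Φ : ℤ → G → B := fun m => ∑ r ∈ Finset.range (k + 1), Ring.choose m r • a r with hΦ
  have hstep : ∀ m, Φ (m + 1) = leftTranslate h (Φ m) := by
    intro m
    have h1 : ∑ r ∈ Finset.range (k + 1), Ring.choose m r • a (r + 1) =
        ∑ r ∈ Finset.range k, Ring.choose m r • a (r + 1) := by
      rw [Finset.sum_range_succ, hk1, smul_zero, add_zero]
    simp only [hΦ]
    rw [sum_choose_succ_smul, ← h1, map_sum, ← Finset.sum_add_distrib]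
    refine Finset.sum_congr rfl fun r _ => ?_
    rw [map_zsmul, ← smul_add, hsucc, add_sub_cancel]
  change _ = Φ m
  induction m using Int.induction_on with
  | zero =>
    rw [zpow_zero, leftTranslate_one, hΦ]
    simp [Ring.choose_zero_ite, ha]
  | succ m ih =>
    rw [hstep, ← ih, ← leftTranslate_mul, zpow_add_one]
  | pred m ih =>
    have h1 := hstep (-m - 1)
    rw [sub_add_cancel, ← ih] at h1
    have h2 := congrArg (leftTranslate h⁻¹) h1
    rwa [← leftTranslate_mul, ← leftTranslate_mul, mul_inv_cancel, leftTranslate_one, ← zpow_sub_one] at h2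

theorem zpow_mem_polyMaps {K : Subgroup G} {h : G} (hh : h ∈ K) {k : ℕ}
    {f : G → B} (hf : f ∈ unipotentFunctions B K k) {P : ℤ → ℤ} (hP : IsIntPoly P) :
    (fun n => leftTranslate (h ^ P n) f) ∈ polyMaps (unipotentFunctions B K k) := by
  have h1 : (fun n => leftTranslate (h ^ P n) f) = ∑ r ∈ Finset.range (k + 1), fun n =>
      Ring.choose (P n) r • ((fun f : G → B => leftTranslate h f - f)^[r] f) := by
    ext1 n
    rw [leftTranslate_zpow_eq_sum hh hf, Finset.sum_apply]
  rw [h1]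
  refine AddSubgroup.sum_mem _ fun r hr =>
    smul_const_mem_polyMaps ((isIntPoly_choose r).comp hP) ?_
  clear h1 hr
  induction r with
  | zero => exact hf
  | succ r ih =>
    rw [Function.iterate_succ_apply']
    cases k with
    | zero =>
      rw [unipotentFunctions, AddSubgroup.mem_bot] at ih ⊢
      rw [ih]; simp
    | succ k => exact unipotentFunctions_mono K (Nat.le_succ k) (ih h hh)

/-- The value at `n` of the product of powers `c ^ P n`. -/
def powProd (L : List (G × (ℤ → ℤ))) (n : ℤ) : G := (L.map fun c => c.1 ^ c.2 n).prod

variable (B) in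
-- The factors c need not lie in K, but c ^ e does. On a residue class each exponent is a constant
-- plus e times an integer-valued polynomial, so each factor is a fixed element times a polynomial
-- power of an element of K. The fixed element preserves the unipotent functions because K is
-- normal.
theorem exists_period_powProd {K : Subgroup G} [hK : K.Normal] {e : ℤ} (he : 0 < e)
    (heK : ∀ c : G, c ^ e ∈ K) (L : List (G × (ℤ → ℤ))) (hL : ∀ c ∈ L, IsIntPoly c.2) :
    ∃ q : ℤ, 0 < q ∧ ∀ q', q ∣ q' → ∀ r,
      (∀ k, ∀ f ∈ unipotentFunctions B K k,
        (fun n => leftTranslate (powProd L (r + q' * n)) f) ∈ polyMaps (unipotentFunctions B K k)) ∧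
      ∀ n, ((powProd L (r + q' * n) : G) : G ⧸ K) = ((powProd L r : G) : G ⧸ K) := by
  induction L with
  | nil =>
    refine ⟨1, one_pos, fun q' _ r => ⟨fun k f hf => ?_, fun n => rfl⟩⟩
    simpa [powProd, leftTranslate_one] using smul_const_mem_polyMaps (isIntPoly_const 1) hf
  | cons c L ih =>
    obtain ⟨q₁, hq₁, h₁⟩ := ih fun c hc => hL c (List.mem_cons_of_mem _ hc)
    obtain ⟨q₂, hq₂, h₂⟩ := (hL c List.mem_cons_self).exists_periodic he
    refine ⟨q₁ * q₂, mul_pos hq₁ hq₂, fun q' hq' r => ?_⟩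
    obtain ⟨ht, hm⟩ := h₁ q' ((dvd_mul_right _ _).trans hq') r
    obtain ⟨P', hP', hP⟩ := h₂ q' ((dvd_mul_left _ _).trans hq') r
    have hcons : ∀ n, powProd (c :: L) n = c.1 ^ c.2 n * powProd L n := fun n => by
      simp [powProd]
    have hpow : ∀ n, c.1 ^ c.2 (r + q' * n) = c.1 ^ c.2 r * (c.1 ^ e) ^ P' n := fun n => by
      rw [hP, zpow_add, zpow_mul]
    refine ⟨fun k f hf => ?_, fun n => ?_⟩
    · simp only [hcons, hpow, leftTranslate_mul]
      -- Translation reverses products: the head factor acts first and gives a polynomial map, to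
      -- whose coefficients the induction hypothesis for the tail applies.
      exact apply_mem_polyMaps (ht k)
        (zpow_mem_polyMaps (heK _) (leftTranslate_mem_unipotentFunctions _ hf) hP')
    · have h1 : (((c.1 ^ e) ^ P' n : G) : G ⧸ K) = 1 :=
        (QuotientGroup.eq_one_iff _).2 (K.zpow_mem (heK _) _)
      rw [hcons, hcons, hpow, QuotientGroup.mk_mul, QuotientGroup.mk_mul, QuotientGroup.mk_mul,
        h1, hm n, mul_one]

end Translation

/-! ### Characters of N extended to NΓ -/

/-- A homomorphism from `N` to an abelian group that is trivial on `N ∩ Γ`. -/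
structure IsLatticeHom {G B : Type*} [Group G] [AddCommGroup B] {N : Subgroup G} (Γ : Subgroup G)
    (χ : N → B) : Prop where
  map_mul : ∀ x y, χ (x * y) = χ x + χ y
  map_mem : ∀ x : N, (x : G) ∈ Γ → χ x = 0

section LatticeHom

variable {G B : Type*} [Group G] [AddCommGroup B] {N Γ : Subgroup G} {χ : N → B}

theorem IsLatticeHom.map_one (hχ : IsLatticeHom Γ χ) : χ 1 = 0 := by
  simpa using hχ.map_mul 1 1

theorem mem_sup_iff_exists_mul [N.Normal] {x : G} :
    x ∈ N ⊔ Γ ↔ ∃ h : N, ∃ γ ∈ Γ, x = h * γ := by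
  rw [Subgroup.mem_sup_of_normal_left]
  constructor
  · rintro ⟨h, hh, γ, hγ, rfl⟩
    exact ⟨⟨h, hh⟩, γ, hγ, rfl⟩
  · rintro ⟨h, γ, hγ, rfl⟩
    exact ⟨h, h.2, γ, hγ, rfl⟩

open Classical in
/-- The function `h γ ↦ χ h` on `N Γ`, extended by zero. -/
noncomputable def torusFun (Γ : Subgroup G) (χ : N → B) (x : G) : B :=
  if hx : ∃ h : N, ∃ γ ∈ Γ, x = h * γ then χ hx.choose else 0

theorem torusFun_mul_mem (hχ : IsLatticeHom Γ χ) (h : N) {γ : G} (hγ : γ ∈ Γ) :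
    torusFun Γ χ (h * γ) = χ h := by
  have hx : ∃ h' : N, ∃ γ' ∈ Γ, (h : G) * γ = h' * γ' := ⟨h, γ, hγ, rfl⟩
  rw [torusFun, dif_pos hx]
  obtain ⟨γ', hγ', heq⟩ := hx.choose_spec
  set h' := hx.choose
  have hmem : ((h'⁻¹ * h : N) : G) ∈ Γ := by
    have : ((h'⁻¹ * h : N) : G) = γ' * γ⁻¹ := by
      rw [Subgroup.coe_mul, Subgroup.coe_inv, eq_mul_inv_iff_mul_eq, mul_assoc, heq]
      group
    rw [this]
    exact Γ.mul_mem hγ' (Γ.inv_mem hγ)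
  have := hχ.map_mul h' (h'⁻¹ * h)
  rw [mul_inv_cancel_left, hχ.map_mem _ hmem, add_zero] at this
  exact this.symm

theorem torusFun_of_notMem [N.Normal] {x : G} (hx : x ∉ N ⊔ Γ) : torusFun Γ χ x = 0 := by
  rw [torusFun, dif_neg (fun h => hx (mem_sup_iff_exists_mul.2 h))]

theorem torusFun_mul_right [N.Normal] (hχ : IsLatticeHom Γ χ) (x : G) {γ : G} (hγ : γ ∈ Γ) :
    torusFun Γ χ (x * γ) = torusFun Γ χ x := by
  by_cases hx : x ∈ N ⊔ Γ
  · obtain ⟨h, γ', hγ', rfl⟩ := mem_sup_iff_exists_mul.1 hx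
    rw [mul_assoc, torusFun_mul_mem hχ h (Γ.mul_mem hγ' hγ), torusFun_mul_mem hχ h hγ']
  · rw [torusFun_of_notMem hx, torusFun_of_notMem]
    rwa [Subgroup.mul_mem_cancel_right _ (Subgroup.mem_sup_right hγ)]

theorem torusFun_mul_left [N.Normal] (hχ : IsLatticeHom Γ χ) (h : N) {x : G} (hx : x ∈ N ⊔ Γ) :
    torusFun Γ χ (h * x) = χ h + torusFun Γ χ x := by
  obtain ⟨h', γ', hγ', rfl⟩ := mem_sup_iff_exists_mul.1 hx
  rw [← mul_assoc, ← Subgroup.coe_mul, torusFun_mul_mem hχ _ hγ', torusFun_mul_mem hχ _ hγ',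
    hχ.map_mul]

/-- The conjugate of an element of a normal subgroup. -/
def Subgroup.conjBy [hN : N.Normal] (γ : G) (h : N) : N := ⟨γ * h * γ⁻¹, hN.conj_mem h h.2 γ⟩

theorem IsLatticeHom.conj_sub [N.Normal] (hχ : IsLatticeHom Γ χ) {γ : G} (hγ : γ ∈ Γ) :
    IsLatticeHom Γ fun h : N => χ (Subgroup.conjBy γ h) - χ h where
  map_mul x y := by
    have : Subgroup.conjBy γ (x * y) = Subgroup.conjBy γ x * Subgroup.conjBy γ y :=
      Subtype.ext (by simp [Subgroup.conjBy])
    rw [this, hχ.map_mul, hχ.map_mul]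
    abel
  map_mem x hx := by
    rw [hχ.map_mem x hx, hχ.map_mem _ (Γ.mul_mem (Γ.mul_mem hγ hx) (Γ.inv_mem hγ)), sub_zero]

theorem indicator_mem_unipotentFunctions {K M : Subgroup G} (hKM : K ≤ M) (a : B) :
    (M : Set G).indicator (fun _ => a) ∈ unipotentFunctions B K 1 := by
  intro h hh
  rw [unipotentFunctions, AddSubgroup.mem_bot, sub_eq_zero]
  ext y
  have hiff : h * y ∈ (M : Set G) ↔ y ∈ (M : Set G) := Subgroup.mul_mem_cancel_left M (hKM hh)
  rw [leftTranslate_apply]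
  by_cases hy : y ∈ (M : Set G)
  · rw [Set.indicator_of_mem hy, Set.indicator_of_mem (hiff.2 hy)]
  · rw [Set.indicator_of_notMem hy, Set.indicator_of_notMem (fun h => hy (hiff.1 h))]

/-- On NΓ, the difference with step h γ is the constant χ(h) plus the torus function of k ↦ χ(γ k
γ⁻¹) - χ(k). The latter is χ of a commutator, so it vanishes one term earlier in the lower central
series than χ does, and induction applies. -/
theorem torusFun_mem_unipotentFunctions [N.Normal] {K : Subgroup G} (hK : K ≤ N ⊔ Γ) (i : ℕ)
    (hχ : IsLatticeHom Γ χ)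
    (hi : ∀ h : N, (h : G) ∈ (⊤ : Subgroup G).lowerCentralSeries i → χ h = 0) :
    torusFun Γ χ ∈ unipotentFunctions B K (i + 1) := by
  induction i generalizing χ with
  | zero =>
    have : torusFun Γ χ = 0 := by
      ext x
      by_cases hx : x ∈ N ⊔ Γ
      · obtain ⟨h', γ', hγ', rfl⟩ := mem_sup_iff_exists_mul.1 hx
        rw [torusFun_mul_mem hχ _ hγ']
        exact hi _ (Subgroup.mem_top _)
      · exact torusFun_of_notMem hx
    rw [this]
    exact AddSubgroup.zero_mem _
  | succ i ih =>
    intro x hx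
    obtain ⟨h, γ, hγ, rfl⟩ := mem_sup_iff_exists_mul.1 (hK hx)
    have hχ' := hχ.conj_sub hγ
    have hdecomp : leftTranslate ((h : G) * γ) (torusFun Γ χ) - torusFun Γ χ =
        ((N ⊔ Γ : Subgroup G) : Set G).indicator (fun _ => χ h) +
          torusFun Γ fun h : N => χ (Subgroup.conjBy γ h) - χ h := by
      ext y
      simp only [Pi.sub_apply, Pi.add_apply, leftTranslate_apply]
      by_cases hy : y ∈ N ⊔ Γ
      · obtain ⟨k, δ, hδ, rfl⟩ := mem_sup_iff_exists_mul.1 hy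
        have hmul : (h : G) * γ * (k * δ) = ((h * Subgroup.conjBy γ k : N) : G) * (γ * δ) := by
          simp [Subgroup.conjBy, mul_assoc]
        rw [Set.indicator_of_mem hy, hmul, torusFun_mul_mem hχ _ (Γ.mul_mem hγ hδ), torusFun_mul_mem hχ _ hδ,
          torusFun_mul_mem hχ' _ hδ, hχ.map_mul]
        abel
      · rw [Set.indicator_of_notMem hy, torusFun_of_notMem hy, torusFun_of_notMem hy, torusFun_of_notMem]
        · simp
        · rwa [Subgroup.mul_mem_cancel_left _ (hK hx)]
    rw [hdecomp]
    refine AddSubgroup.add_mem _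
      (unipotentFunctions_mono K (Nat.le_add_left 1 i) (indicator_mem_unipotentFunctions hK _))
      (ih hχ' fun k hk => ?_)
    have hc : ((Subgroup.conjBy γ k * k⁻¹ : N) : G) ∈
        (⊤ : Subgroup G).lowerCentralSeries (i + 1) := by
      have h1 : ((Subgroup.conjBy γ k * k⁻¹ : N) : G) = ⁅(k : G), γ⁆⁻¹ := by
        simp [Subgroup.conjBy, commutatorElement_def, mul_assoc]
      rw [h1]
      exact Subgroup.inv_mem _ (Subgroup.commutator_mem_commutator hk (Subgroup.mem_top _))
    have h2 := hχ.map_mul (Subgroup.conjBy γ k * k⁻¹) k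
    rw [inv_mul_cancel_right, hi _ hc, zero_add] at h2
    exact sub_eq_zero.2 h2

theorem exists_torusFun_mem_unipotentFunctions [Group.IsNilpotent G] [N.Normal] {K : Subgroup G}
    (hK : K ≤ N ⊔ Γ) (hχ : IsLatticeHom Γ χ) :
    ∃ k, torusFun Γ χ ∈ unipotentFunctions B K k := by
  obtain ⟨n, hn⟩ := Subgroup.nilpotent_iff_lowerCentralSeries.1 ‹Group.IsNilpotent G›
  refine ⟨n + 1, torusFun_mem_unipotentFunctions hK n hχ fun h hh => ?_⟩
  rw [hn, Subgroup.mem_bot] at hh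
  rw [show h = 1 from Subtype.ext hh, hχ.map_one]

end LatticeHom

/-! ### Tent functions and the obstruction to equidistribution -/

/-- A tent function on the circle supported in the arc of length `1 / n` around `0`. -/
noncomputable def circleTent (n : ℕ) (z : UnitAddCircle) : ℝ := max 0 (1 - 2 * n * ‖z‖)

theorem continuous_circleTent (n : ℕ) : Continuous (circleTent n) := by
  unfold circleTent
  fun_prop

theorem circleTent_nonneg (n : ℕ) (z : UnitAddCircle) : 0 ≤ circleTent n z := le_max_left _ _

theorem circleTent_zero (n : ℕ) : circleTent n 0 = 1 := by simp [circleTent]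

theorem circleTent_le_one (n : ℕ) (z : UnitAddCircle) : circleTent n z ≤ 1 := by
  refine max_le zero_le_one ?_
  have : 0 ≤ 2 * (n : ℝ) * ‖z‖ := by positivity
  linarith

theorem norm_lt_of_circleTent_ne_zero {n : ℕ} {z : UnitAddCircle}
    (h : circleTent n z ≠ 0) : 2 * n * ‖z‖ < 1 := by
  by_contra hcon
  exact h (max_eq_left (by linarith))

/-- The tents live on open arcs of length 1 / n whose centres are 1 / n apart, so at most one term
is nonzero. -/
theorem sum_circleTent_le_one {n : ℕ} (hn : 0 < n) (z : UnitAddCircle) :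
    ∑ k ∈ Finset.range n, circleTent n ((((k : ℝ) / n : ℝ) : UnitAddCircle) + z) ≤ 1 := by
  by_cases h : ∃ k ∈ Finset.range n, circleTent n ((((k : ℝ) / n : ℝ) : UnitAddCircle) + z) ≠ 0
  · obtain ⟨k, hk, hk0⟩ := h
    rw [Finset.sum_eq_single_of_mem k hk]
    · exact circleTent_le_one _ _
    intro l hl hlk
    by_contra hl0
    have h1 := norm_lt_of_circleTent_ne_zero hk0
    have h2 := norm_lt_of_circleTent_ne_zero hl0
    have hn' : (0 : ℝ) < n := by exact_mod_cast hn
    have h3 : (n : ℝ) * ‖((((k : ℝ) / n - l / n : ℝ)) : UnitAddCircle)‖ < 1 := by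
      have h4 := norm_sub_le ((((k : ℝ) / n : ℝ) : UnitAddCircle) + z)
        ((((l : ℝ) / n : ℝ) : UnitAddCircle) + z)
      rw [add_sub_add_right_eq_sub, ← AddCircle.coe_sub] at h4
      nlinarith
    rw [UnitAddCircle.norm_eq] at h3
    set m := round ((k : ℝ) / n - l / n)
    have h5 : |(((k : ℤ) - l - n * m : ℤ) : ℝ)| < 1 := by
      have : (((k : ℤ) - l - n * m : ℤ) : ℝ) = n * ((k : ℝ) / n - l / n - m) := by
        push_cast
        field_simp
      rwa [this, abs_mul, abs_of_pos hn']
    have h6 : (k : ℤ) - l - n * m = 0 := by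
      rw [← Int.abs_lt_one_iff]
      exact_mod_cast h5
    rw [Finset.mem_range] at hk hl
    have h7 : (n : ℤ) ∣ (k : ℤ) - l := ⟨m, by linarith⟩
    have h8 : (k : ℤ) - l = 0 := Int.eq_zero_of_abs_lt_dvd h7 (by rw [abs_lt]; omega)
    omega
  · push Not at h
    rw [Finset.sum_eq_zero h]
    exact zero_le_one

theorem inv_le_of_tendsto_average {a : ℕ → ℝ} (ha : ∀ n, 0 ≤ a n) {q r : ℕ} (hr : r < q)
    (har : ∀ k, a (r + q * k) = 1) {I : ℝ}
    (hI : Tendsto (fun N : ℕ => (∑ n ∈ Finset.range N, a n) / (N : ℝ)) atTop (𝓝 I)) :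
    (q : ℝ)⁻¹ ≤ I := by
  have hq : 0 < q := by omega
  have hsub : Tendsto (fun K : ℕ => q * (K + 1)) atTop atTop :=
    (tendsto_add_atTop_nat 1).const_mul_atTop' hq
  refine ge_of_tendsto (hI.comp hsub) (Eventually.of_forall fun K => ?_)
  have hinj : Function.Injective fun k : ℕ => r + q * k := fun k l hkl => by
    simpa [hq.ne'] using hkl
  have hsum : ((K + 1 : ℕ) : ℝ) ≤ ∑ n ∈ Finset.range (q * (K + 1)), a n := by
    calc ((K + 1 : ℕ) : ℝ) = ∑ k ∈ Finset.range (K + 1), a (r + q * k) := by simp [har]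
      _ = ∑ n ∈ (Finset.range (K + 1)).map ⟨_, hinj⟩, a n := by simp
      _ ≤ _ := by
        refine Finset.sum_le_sum_of_subset_of_nonneg (fun n hn => ?_) fun n _ _ => ha n
        obtain ⟨k, hk, rfl⟩ := Finset.mem_map.1 hn
        rw [Finset.mem_range] at hk ⊢
        change r + q * k < q * (K + 1)
        nlinarith
  have hq' : (0 : ℝ) < q := by exact_mod_cast hq
  have hK : (0 : ℝ) < (K + 1 : ℕ) := by positivity
  simp only [Function.comp]
  rw [Nat.cast_mul, le_div_iff₀ (by positivity), inv_mul_cancel_left₀ hq'.ne']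
  exact hsum

/-- By invariance all n translates of f have the same integral, and their sum is at most 1. -/
theorem mul_integral_le_one_of_sum_smul_le_one {G X : Type*} [Group G] [MulAction G X]
    [TopologicalSpace X] [CompactSpace X] [MeasurableSpace X] [BorelSpace X]
    [ContinuousConstSMul G X] (μ : Measure X) [IsProbabilityMeasure μ] [SMulInvariantMeasure G X μ]
    {f : X → ℝ} (hf : Continuous f) (n : ℕ) (s : ℕ → G)
    (h : ∀ x, ∑ k ∈ Finset.range n, f (s k • x) ≤ 1) : n * ∫ x, f x ∂μ ≤ 1 := by
  have hint : ∀ k, Integrable (fun x => f (s k • x)) μ := fun k =>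
    (hf.comp (continuous_const_smul (s k))).integrable_of_hasCompactSupport
      (HasCompactSupport.of_compactSpace _)
  calc n * ∫ x, f x ∂μ = ∑ k ∈ Finset.range n, ∫ x, f (s k • x) ∂μ := by
        simp [integral_smul_eq_self]
    _ = ∫ x, ∑ k ∈ Finset.range n, f (s k • x) ∂μ :=
        (integral_finsetSum _ fun k _ => hint k).symm
    _ ≤ ∫ _, (1 : ℝ) ∂μ :=
        integral_mono (integrable_finsetSum _ fun k _ => hint k) (integrable_const _) h
    _ = 1 := by simp

section

variable {G : Type*} [Group G] {N Γ : Subgroup G} [N.Normal] {η : N → UnitAddCircle}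

open Classical in
/-- A tent function of `torusFun`, supported in `N Γ`. -/
noncomputable def torusTent (Γ : Subgroup G) (η : N → UnitAddCircle) (n : ℕ) (c : UnitAddCircle)
    (x : G) : ℝ :=
  if x ∈ N ⊔ Γ then circleTent n (torusFun Γ η x - c) else 0

theorem torusTent_mul_right (hη : IsLatticeHom Γ η) (n : ℕ) (c : UnitAddCircle) (x : G) {γ : G}
    (hγ : γ ∈ Γ) : torusTent Γ η n c (x * γ) = torusTent Γ η n c x := by
  have hiff : x * γ ∈ N ⊔ Γ ↔ x ∈ N ⊔ Γ :=
    Subgroup.mul_mem_cancel_right _ (Subgroup.mem_sup_right hγ)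
  rw [torusTent, torusTent, torusFun_mul_right hη x hγ]
  by_cases hx : x ∈ N ⊔ Γ
  · rw [if_pos hx, if_pos (hiff.2 hx)]
  · rw [if_neg hx, if_neg (fun h => hx (hiff.1 h))]

variable [TopologicalSpace G] [IsTopologicalGroup G]

theorem continuous_torusTent (hN : IsOpen (N : Set G)) (hη : IsLatticeHom Γ η)
    (hcont : Continuous η) (n : ℕ) (c : UnitAddCircle) : Continuous (torusTent Γ η n c) := by
  rw [continuous_iff_continuousAt]
  intro x
  -- Since N is open, continuity at x may be tested along the orbit map h ↦ h x, on which the torus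
  -- function is η(h) plus a constant.
  have hemb : Topology.IsOpenEmbedding fun h : N => (h : G) * x :=
    (Homeomorph.mulRight x).isOpenEmbedding.comp hN.isOpenEmbedding_subtypeVal
  have h1 := hemb.continuousAt_iff (g := torusTent Γ η n c) (x := 1)
  rw [Subgroup.coe_one, one_mul] at h1
  refine h1.1 (Continuous.continuousAt ?_)
  by_cases hx : x ∈ N ⊔ Γ
  · have : torusTent Γ η n c ∘ (fun h : N => (h : G) * x) =
        fun h => circleTent n (η h + torusFun Γ η x - c) := by
      ext h
      rw [Function.comp, torusTent,
        if_pos (Subgroup.mul_mem _ (Subgroup.mem_sup_left h.2) hx), torusFun_mul_left hη h hx]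
    rw [this]
    exact (continuous_circleTent n).comp (by fun_prop)
  · have : torusTent Γ η n c ∘ (fun h : N => (h : G) * x) = fun _ => 0 := by
      ext h
      rw [Function.comp, torusTent, if_neg]
      rwa [Subgroup.mul_mem_cancel_left _ (Subgroup.mem_sup_left h.2)]
    rw [this]
    exact continuous_const

/-- An equidistributed sequence cannot, along an arithmetic progression, stay in a level set of a
character of a component of `G ⧸ Γ`. -/
theorem not_isEquidistributed_of_torusFun_eq_const [CompactSpace (G ⧸ Γ)] [MeasurableSpace (G ⧸ Γ)]
    [BorelSpace (G ⧸ Γ)] (hN : IsOpen (N : Set G)) (hη : IsLatticeHom Γ η)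
    (hcont : Continuous η) (hsurj : Function.Surjective η) {g : ℤ → G} {b : G} {c : UnitAddCircle}
    {q r : ℤ} (hq : 0 < q) (hmem : ∀ n, b⁻¹ * g (r + q * n) ∈ N ⊔ Γ)
    (hconst : ∀ n, torusFun Γ η (b⁻¹ * g (r + q * n)) = c) : ¬ IsEquidistributed Γ g := by
  rintro ⟨μ, hμ, hinv, hlim⟩
  obtain ⟨q, rfl⟩ := Int.eq_ofNat_of_zero_le hq.le
  have hq0 : 0 < q := by exact_mod_cast hq
  -- The factor 2 makes the upper bound 1 / (2q) for the integral smaller than the density 1 / q of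
  -- the progression.
  set n := 2 * q with hn
  let u : G → ℝ := fun x => torusTent Γ η n c (b⁻¹ * x)
  have hu : Continuous u := (continuous_torusTent hN hη hcont n c).comp (by fun_prop)
  let F : G ⧸ Γ → ℝ := Quotient.lift u fun x y hxy => by
    have h1 : x⁻¹ * y ∈ Γ := QuotientGroup.leftRel_apply.1 hxy
    have h2 := torusTent_mul_right hη n c (b⁻¹ * x) h1
    rw [mul_assoc, mul_inv_cancel_left] at h2
    exact h2.symm
  have hFu : ∀ x : G, F (x : G ⧸ Γ) = u x := fun x => rfl
  have hF : Continuous F := hu.quotient_lift _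
  have hsel : ∀ k : ℕ, ∃ h : N, η h = (((k : ℝ) / n : ℝ) : UnitAddCircle) := fun k => hsurj _
  choose h hh using hsel
  -- Left translation by b (h k) b⁻¹ shifts the torus coordinate on the component b NΓ by k / n.
  have hupper : n * ∫ x, F x ∂μ ≤ 1 := by
    refine mul_integral_le_one_of_sum_smul_le_one μ hF n (fun k => b * h k * b⁻¹) fun x => ?_
    obtain ⟨x, rfl⟩ := QuotientGroup.mk_surjective x
    by_cases hx : b⁻¹ * x ∈ N ⊔ Γ
    · refine (Finset.sum_congr rfl fun k _ => ?_).trans_le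
        (sum_circleTent_le_one (by omega) (torusFun Γ η (b⁻¹ * x) - c))
      change torusTent Γ η n c (b⁻¹ * (b * h k * b⁻¹ * x)) = _
      have : b⁻¹ * (b * h k * b⁻¹ * x) = h k * (b⁻¹ * x) := by group
      rw [this, torusTent, if_pos (Subgroup.mul_mem _ (Subgroup.mem_sup_left (h k).2) hx),
        torusFun_mul_left hη _ hx, hh, add_sub_assoc]
    · refine (Finset.sum_eq_zero fun k _ => ?_).trans_le zero_le_one
      change torusTent Γ η n c (b⁻¹ * (b * h k * b⁻¹ * x)) = _
      have : b⁻¹ * (b * h k * b⁻¹ * x) = h k * (b⁻¹ * x) := by group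
      rw [this, torusTent, if_neg]
      rwa [Subgroup.mul_mem_cancel_left _ (Subgroup.mem_sup_left (h k).2)]
  have hlower : (q : ℝ)⁻¹ ≤ ∫ x, F x ∂μ := by
    -- Equidistribution concerns n ≥ 0, so r is replaced by its residue in [0, q).
    have hr0 := Int.emod_nonneg r hq.ne'
    have hrq := Int.emod_lt_of_pos r hq
    refine inv_le_of_tendsto_average (a := fun m : ℕ => F (g (m : ℤ) : G ⧸ Γ)) (fun m => ?_)
      (r := (r % q).toNat) (by omega) (fun k => ?_) (hlim ⟨F, hF⟩)
    · rw [hFu]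
      change 0 ≤ torusTent Γ η n c _
      rw [torusTent]
      split_ifs
      · exact circleTent_nonneg _ _
      · exact le_rfl
    · rw [hFu]
      have : (((r % q).toNat + q * k : ℕ) : ℤ) = r + q * (k - r / q) := by
        push_cast
        rw [Int.toNat_of_nonneg hr0]
        have := Int.emod_add_mul_ediv r q
        linarith
      rw [this]
      change torusTent Γ η n c _ = 1
      rw [torusTent, if_pos (hmem _), hconst, sub_self, circleTent_zero]
  have hq' : (0 : ℝ) < q := by exact_mod_cast hq0
  have h1 := mul_le_mul_of_nonneg_left hlower hq'.le
  rw [mul_inv_cancel₀ hq'.ne'] at h1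
  rw [hn] at hupper
  push_cast at hupper
  linarith

end

/-! ### Pigeonhole and finite index -/

theorem Set.Infinite.exists_infinite_fiber {α β : Type*} {I : Set α} (hI : I.Infinite)
    {f : α → β} {T : Set β} (hT : T.Finite) (hf : ∀ x ∈ I, f x ∈ T) :
    ∃ t ∈ T, {x ∈ I | f x = t}.Infinite := by
  by_contra! hcon
  refine hI ((hT.biUnion fun t ht => hcon t ht).subset fun x hx => ?_)
  exact Set.mem_biUnion (hf x hx) ⟨hx, rfl⟩

theorem Set.Infinite.exists_infinite_fiber_of_sub_mem_int {α : Type*} {I : Set α} (hI : I.Infinite)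
    {f : α → ℝ} {v K : ℝ} (hf : ∀ x ∈ I, ∃ k : ℤ, f x = v + k) (hK : ∀ x ∈ I, |f x| ≤ K) :
    ∃ t, {x ∈ I | f x = t}.Infinite := by
  have hfin : ((fun k : ℤ => v + (k : ℝ)) '' Set.Icc ⌊-K - v⌋ ⌈K - v⌉).Finite :=
    (Set.finite_Icc _ _).image _
  obtain ⟨t, -, ht⟩ := hI.exists_infinite_fiber hfin fun x hx => by
    obtain ⟨k, hk⟩ := hf x hx
    have hb := abs_le.1 (hK x hx)
    rw [hk] at hb
    refine ⟨k, ⟨?_, ?_⟩, hk.symm⟩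
    · have h1 : ((⌊-K - v⌋ : ℤ) : ℝ) ≤ k := (Int.floor_le _).trans (by linarith [hb.1])
      exact_mod_cast h1
    · have h1 : (k : ℝ) ≤ (⌈K - v⌉ : ℤ) := le_trans (by linarith [hb.2]) (Int.le_ceil _)
      exact_mod_cast h1
  exact ⟨t, ht⟩

theorem normal_connectedComponentOfOne (G : Type*) [Group G] [TopologicalSpace G]
    [IsTopologicalGroup G] : (Subgroup.connectedComponentOfOne G).Normal where
  conj_mem n hn g := by
    have hc : Continuous fun x : G => g * x * g⁻¹ := by fun_prop
    have h1 := hc.image_connectedComponent_subset 1 (Set.mem_image_of_mem _ hn)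
    rwa [mul_one, mul_inv_cancel] at h1

theorem finiteIndex_of_isOpen_of_le {G : Type*} [Group G] [TopologicalSpace G]
    [IsTopologicalGroup G] {Γ M : Subgroup G} [CompactSpace (G ⧸ Γ)] (hM : IsOpen (M : Set G))
    (hΓ : Γ ≤ M) : M.FiniteIndex := by
  have hcont : Continuous (Subgroup.quotientMapOfLE hΓ) :=
    Continuous.quotient_lift QuotientGroup.continuous_mk _
  have hsurj : Function.Surjective (Subgroup.quotientMapOfLE hΓ) := fun x => by
    obtain ⟨x, rfl⟩ := QuotientGroup.mk_surjective x
    exact ⟨x, rfl⟩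
  have : CompactSpace (G ⧸ M) := hsurj.compactSpace hcont
  have : DiscreteTopology (G ⧸ M) := QuotientGroup.discreteTopology hM
  have : Finite (G ⧸ M) := finite_of_compact_of_discrete
  exact Subgroup.finiteIndex_of_finite_quotient

/-! ### Proper closed subgroups and characters in Mal'cev coordinates -/

namespace MalcevBasis

variable {N : Type*} [Group N] [TopologicalSpace N] {Λ : Subgroup N} (B : MalcevBasis N Λ)

theorem topologicalClosure_sup_eq_top_of_dense [IsTopologicalGroup N] {H : Subgroup N}
    (hd : Dense (B.theta '' H)) :
    (H ⊔ (⊤ : Subgroup N).lowerCentralSeries 1).topologicalClosure = ⊤ := by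
  rw [eq_top_iff]
  intro x _
  -- This map sends θ(x) to x, and sends θ(h) to an element with the same θ as h, hence into H[N,N].
  -- Approximating θ(x) by such θ(h) therefore approximates x.
  have hcont : Continuous fun s => x * (B.coordProd (B.extend (B.theta x - s)))⁻¹ := by
    have h1 := B.continuous_coordProd.comp B.continuous_extend
    exact continuous_const.mul (h1.comp (by fun_prop)).inv
  have h1 := map_mem_closure hcont (hd (B.theta x))
    (t := ((H ⊔ (⊤ : Subgroup N).lowerCentralSeries 1 : Subgroup N) : Set N)) (by
      rintro _ ⟨h, hh, rfl⟩
      set y := x * (B.coordProd (B.extend (B.theta x - B.theta h)))⁻¹ with hy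
      have h2 : B.theta h = B.theta y := by
        rw [hy, theta_mul, theta_inv, theta_coordProd_extend]
        abel
      have h3 := Subgroup.mul_mem_sup hh (B.theta_eq_theta_iff.1 h2)
      rwa [mul_inv_cancel_left] at h3)
  rw [sub_self, extend_zero, coordProd_zero, inv_one, mul_one] at h1
  exact h1

/-- Some nonzero linear form takes integral values on the abelianization of a closed proper
subgroup. -/
theorem exists_linearMap_int_of_ne_top [IsTopologicalGroup N] [Group.IsNilpotent N]
    {H : Subgroup N} (hH : IsClosed (H : Set N)) (hne : H ≠ ⊤) :
    ∃ l : (B.ZeroIdx → ℝ) →ₗ[ℝ] ℝ, l ≠ 0 ∧ ∀ h ∈ H, ∃ k : ℤ, l (B.theta h) = k := by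
  let A : AddSubgroup (B.ZeroIdx → ℝ) :=
    { carrier := B.theta '' H
      add_mem' := by
        rintro _ _ ⟨x, hx, rfl⟩ ⟨y, hy, rfl⟩
        exact ⟨x * y, H.mul_mem hx hy, B.theta_mul x y⟩
      zero_mem' := ⟨1, H.one_mem, B.theta_one⟩
      neg_mem' := by
        rintro _ ⟨x, hx, rfl⟩
        exact ⟨x⁻¹, H.inv_mem hx, B.theta_inv x⟩ }
  have hA : A.topologicalClosure ≠ ⊤ := fun htop =>
    hne <| eq_top_of_topologicalClosure_sup_eq_top hH <|
      B.topologicalClosure_sup_eq_top_of_dense fun x => by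
        have : x ∈ A.topologicalClosure := htop ▸ AddSubgroup.mem_top x
        exact this
  obtain ⟨l, hl0, hl⟩ := AddSubgroup.exists_linearMap_ne_zero_forall_int
    A.isClosed_topologicalClosure hA
  exact ⟨l, hl0, fun h hh => hl _ (A.le_topologicalClosure ⟨h, hh, rfl⟩)⟩

end MalcevBasis

section Characters

variable {G : Type*} [Group G] [TopologicalSpace G] {N Γ : Subgroup G}
  (B : MalcevBasis N (Γ.subgroupOf N))

/-- The character of `N` with integral frequency vector `ξ`. -/
noncomputable def MalcevBasis.character (ξ : B.ZeroIdx → ℤ) (h : N) : UnitAddCircle :=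
  ((∑ j, ξ j * B.theta h j : ℝ) : UnitAddCircle)

theorem MalcevBasis.isLatticeHom_character [Group.IsNilpotent N] (ξ : B.ZeroIdx → ℤ) :
    IsLatticeHom Γ (B.character ξ) where
  map_mul x y := by
    rw [MalcevBasis.character, B.theta_mul]
    simp [MalcevBasis.character, mul_add, Finset.sum_add_distrib]
  map_mem x hx := by
    choose m hm using B.theta_int_of_mem (Subgroup.mem_subgroupOf.2 hx)
    rw [MalcevBasis.character, AddCircle.coe_eq_zero_iff]
    exact ⟨∑ j, ξ j * m j, by simp [hm]⟩

theorem MalcevBasis.continuous_character [IsTopologicalGroup N] [LocallyCompactSpace N] [T2Space N]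
    [Group.IsNilpotent N] (ξ : B.ZeroIdx → ℤ) : Continuous (B.character ξ) := by
  have h1 := B.continuous_theta
  exact (AddCircle.continuous_mk' 1).comp (by fun_prop)

theorem MalcevBasis.character_surjective {ξ : B.ZeroIdx → ℤ} (hξ : ξ ≠ 0) :
    Function.Surjective (B.character ξ) := by
  classical
  intro z
  obtain ⟨s, rfl⟩ := QuotientAddGroup.mk_surjective z
  obtain ⟨j, hj⟩ := Function.ne_iff.1 hξ
  have hj' : (ξ j : ℝ) ≠ 0 := by exact_mod_cast hj
  refine ⟨B.coordProd (B.extend (Pi.single j (s / ξ j))), ?_⟩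
  rw [MalcevBasis.character, B.theta_coordProd_extend]
  congr 1
  rw [Finset.sum_eq_single_of_mem j (Finset.mem_univ j) fun k _ hk => by simp [hk]]
  simp only [Pi.single_eq_same]
  field_simp

end Characters

/-! ### Proof of the theorem -/

/-- A closed subgroup `H` containing infinitely many fractional parts of an equidistributed
polynomial sequence contains any open normal subgroup `N` with a Mal'cev basis. -/
theorem le_of_infinite_fractionalParts {G : Type*} [Group G] [TopologicalSpace G]
    [IsTopologicalGroup G] [Group.IsNilpotent G] {N Γ : Subgroup G} [N.Normal]
    [LocallyCompactSpace N] [T2Space N] (hN : IsOpen (N : Set G)) [CompactSpace (G ⧸ Γ)]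
    [MeasurableSpace (G ⧸ Γ)] [BorelSpace (G ⧸ Γ)] (B : MalcevBasis N (Γ.subgroupOf N))
    {reps : Set G} (hreps : ∀ x : G, ∃! b : G, b ∈ reps ∧ ∃ h ∈ N, ∃ γ ∈ Γ, x = b * h * γ)
    {g : ℤ → G} (hg : IsPolynomialSequence g) (hequi : IsEquidistributed Γ g)
    {H : Subgroup G} (hH : IsClosed (H : Set G)) {I : Set ℤ} (hI : I.Infinite)
    (hfrac : ∀ n ∈ I, ∃ b ∈ reps, ∃ d ∈ B.fundamentalDomain, b * (d : G) ∈ H ∧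
      ∃ γ ∈ Γ, g n = b * d * γ) : N ≤ H := by
  by_contra hNH
  have hne : H.subgroupOf N ≠ ⊤ := fun h => hNH (Subgroup.subgroupOf_eq_top.1 h)
  obtain ⟨l, hl0, hl⟩ := B.exists_linearMap_int_of_ne_top
    (hH.preimage continuous_subtype_val : IsClosed ((H.subgroupOf N : Subgroup N) : Set N)) hne
  have hM : IsOpen ((N ⊔ Γ : Subgroup G) : Set G) :=
    Subgroup.isOpen_mono (le_sup_left : N ≤ N ⊔ Γ) hN
  have hMfin : (N ⊔ Γ).FiniteIndex := finiteIndex_of_isOpen_of_le hM le_sup_right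
  -- K is normal of finite index, so every c ^ K.index lies in K; and K ≤ NΓ makes the torus
  -- functions unipotent for steps in K.
  set K := (N ⊔ Γ).normalCore with hK
  have hKM : K ≤ N ⊔ Γ := Subgroup.normalCore_le _
  have hKfin : K.FiniteIndex := inferInstance
  obtain ⟨a, -, hga⟩ := hg
  set L : List (G × (ℤ → ℤ)) := (List.range (Group.nilpotencyClass G + 1)).map
    fun i => (a i, fun n => Ring.choose n i) with hL
  have hgL : ∀ n, g n = powProd L n := fun n => by
    rw [hga, powProd, hL, List.map_map]
    rfl
  obtain ⟨q, hq, hper⟩ := exists_period_powProd UnitAddCircle (K := K) (e := K.index)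
    (by exact_mod_cast Nat.pos_of_ne_zero hKfin.index_ne_zero)
    (fun c => by rw [zpow_natCast]; exact K.pow_index_mem c) L (fun c hc => by
      obtain ⟨i, -, rfl⟩ := List.mem_map.1 hc
      exact isIntPoly_choose i)
  replace hper := hper q dvd_rfl
  choose! b hb d hd hbd γ hγ hgn using hfrac
  -- restrict to one component and one residue class
  obtain ⟨⟨t, r₀⟩, -, hI₁⟩ := hI.exists_infinite_fiber
    (f := fun n => ((g n : G ⧸ (N ⊔ Γ)), n % q)) (T := Set.univ ×ˢ Set.Ico 0 q)
    (Set.finite_univ.prod (Set.finite_Ico 0 q)) fun n _ =>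
      ⟨Set.mem_univ _, Int.emod_nonneg n hq.ne', Int.emod_lt_of_pos n hq⟩
  set I₁ := {n ∈ I | ((g n : G ⧸ (N ⊔ Γ)), n % q) = (t, r₀)} with hI₁def
  obtain ⟨r, hrI, hr⟩ := hI₁.nonempty
  have hcoset : ∀ n ∈ I₁, ∃ m ∈ N ⊔ Γ, g r = g n * m := fun n hn => by
    have h1 : (g n : G ⧸ (N ⊔ Γ)) = g r :=
      (congrArg Prod.fst hn.2).trans (congrArg Prod.fst hr).symm
    exact ⟨(g n)⁻¹ * g r, QuotientGroup.eq.1 h1, by group⟩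
  have hbr : ∀ n ∈ I₁, b n = b r := fun n hn => by
    obtain ⟨m, hm, hgm⟩ := hcoset n hn
    refine (hreps (g r)).unique ⟨hb n hn.1, ?_⟩
      ⟨hb r hrI, d r, (d r).2, γ r, hγ r hrI, hgn r hrI⟩
    have h1 : (d n : G) * γ n * m ∈ N ⊔ Γ := Subgroup.mul_mem _ (Subgroup.mul_mem _
      (Subgroup.mem_sup_left (d n).2) (Subgroup.mem_sup_right (hγ n hn.1))) hm
    obtain ⟨h, δ, hδ, hhδ⟩ := mem_sup_iff_exists_mul.1 h1
    refine ⟨h, h.2, δ, hδ, ?_⟩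
    rw [hgm, hgn n hn.1, mul_assoc (b n) h δ, ← hhδ]
    group
  have hdn : ∀ n ∈ I₁, (b r)⁻¹ * g n = d n * γ n := fun n hn => by
    rw [hgn n hn.1, hbr n hn]
    group
  -- the fractional parts lie on finitely many hyperplanes
  have hθ : ∀ n ∈ I₁, ∀ j, |B.theta (d n) j| ≤ 1 := fun n hn j => by
    obtain ⟨s, hs, hds⟩ := hd n hn.1
    have h1 : B.theta (d n) j = s j := by
      rw [hds]
      exact congrFun (B.theta_coordProd s) j
    rw [h1, abs_le]
    exact ⟨by linarith [(hs j).1], (hs j).2.le⟩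
  classical
  have hlsum : ∀ v : B.ZeroIdx → ℝ, l v = ∑ j, l (Pi.single j 1) * v j := fun v => by
    conv_lhs => rw [pi_eq_sum_univ' v]
    simp [map_sum, mul_comm]
  -- The quotients (d r)⁻¹ * d n lie in H ∩ N, so the values of l differ by integers; they are
  -- bounded by ∑ |l j| since the coordinates of d n lie in [0, 1).
  obtain ⟨c, hI₂⟩ := hI₁.exists_infinite_fiber_of_sub_mem_int (f := fun n => l (B.theta (d n)))
    (v := l (B.theta (d r))) (K := ∑ j, |l (Pi.single j 1)|) (fun n hn => by
      have h1 : (d r)⁻¹ * d n ∈ H.subgroupOf N := by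
        rw [Subgroup.mem_subgroupOf]
        have h2 := H.mul_mem (H.inv_mem (hbd r hrI)) (hbd n hn.1)
        rw [hbr n hn] at h2
        have h3 : (b r * (d r : G))⁻¹ * (b r * d n) = (((d r)⁻¹ * d n : N) : G) := by
          simp [mul_assoc]
        rwa [h3] at h2
      obtain ⟨k, hk⟩ := hl _ h1
      refine ⟨k, ?_⟩
      rw [B.theta_mul, B.theta_inv, map_add, map_neg] at hk
      linarith) (fun n hn => by
      rw [hlsum]
      refine (Finset.abs_sum_le_sum_abs _ _).trans (Finset.sum_le_sum fun j _ => ?_)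
      rw [abs_mul]
      exact mul_le_of_le_one_right (abs_nonneg _) (hθ n hn j))
  -- the torus coordinates are polynomial along the residue class
  have hpoly : ∀ j : B.ZeroIdx, ∃ p : Polynomial ℝ, ∀ n : ℤ,
      torusFun Γ (B.character (Pi.single j 1)) ((b r)⁻¹ * g (r + q * n)) =
        ((p.eval (n : ℝ) : ℝ) : UnitAddCircle) := fun j => by
    obtain ⟨k, hk⟩ := exists_torusFun_mem_unipotentFunctions hKM
      (B.isLatticeHom_character (Pi.single j 1))
    -- The torus function is pre-translated by (b r)⁻¹; evaluation at 1 then turns polynomial maps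
    -- of functions into polynomial maps to the circle.
    have h1 := (hper r).1 k _ (leftTranslate_mem_unipotentFunctions (b r)⁻¹ hk)
    have h2 := apply_mem_polyMaps (S' := (⊤ : AddSubgroup UnitAddCircle))
      (T := fun _ => Pi.evalAddMonoidHom (fun _ : G => UnitAddCircle) 1)
      (fun f _ => by
        simpa using smul_const_mem_polyMaps (S := (⊤ : AddSubgroup UnitAddCircle))
          (isIntPoly_const 1) (AddSubgroup.mem_top (f 1))) h1
    obtain ⟨p, hp⟩ := exists_polynomial_of_mem_polyMaps h2
    refine ⟨p, fun n => ?_⟩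
    rw [← hp, hgL]
    simp [leftTranslate_apply]
  choose p hp using hpoly
  have hmem : ∀ n, (b r)⁻¹ * g (r + q * n) ∈ N ⊔ Γ := fun n => by
    have h1 : (g r)⁻¹ * g (r + q * n) ∈ N ⊔ Γ := by
      rw [hgL, hgL]
      exact hKM (QuotientGroup.eq.1 ((hper r).2 n).symm)
    have h2 : (b r)⁻¹ * g r ∈ N ⊔ Γ := by
      rw [hdn r ⟨hrI, hr⟩]
      exact Subgroup.mul_mem _ (Subgroup.mem_sup_left (d r).2)
        (Subgroup.mem_sup_right (hγ r hrI))
    have h3 := Subgroup.mul_mem _ h2 h1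
    rwa [mul_assoc, mul_inv_cancel_left] at h3
  set I₂ := {n ∈ I₁ | l (B.theta (d n)) = c} with hI₂def
  have hI₃ : {m : ℤ | r + q * m ∈ I₂}.Infinite := by
    intro hfin
    refine hI₂ ((hfin.image fun m => r + q * m).subset fun n hn => ?_)
    have h1 : r % q = n % q :=
      (congrArg Prod.snd hr).trans (congrArg Prod.snd hn.1.2).symm
    obtain ⟨m, hm⟩ := Int.ModEq.dvd h1
    have h2 : r + q * m = n := by linarith
    exact ⟨m, by simpa [h2] using hn, h2⟩
  obtain ⟨ξ, hξ, c₁, hc₁⟩ := exists_int_combination_eq_const (l := fun j => l (Pi.single j 1))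
    (by
      by_contra! h0
      exact hl0 (LinearMap.ext fun v => by rw [hlsum]; simp [h0])) p c 1 hI₃ (fun m hm => by
      -- Both p j and the j-th coordinate of d represent the same point of the circle; their
      -- difference is the integer z j.
      have h1 : ∀ j, ∃ k : ℤ, (p j).eval (m : ℝ) - B.theta (d (r + q * m)) j = k := fun j => by
        have h2 := hp j m
        rw [hdn _ hm.1, torusFun_mul_mem (B.isLatticeHom_character _) _ (hγ _ hm.1.1),
          MalcevBasis.character, eq_comm, ← sub_eq_zero, ← AddCircle.coe_sub,
          AddCircle.coe_eq_zero_iff] at h2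
        obtain ⟨k, hk⟩ := h2
        refine ⟨k, ?_⟩
        rw [Finset.sum_eq_single_of_mem j (Finset.mem_univ j) fun k _ hk => by simp [hk]] at hk
        simpa using hk.symm
      choose z hz using h1
      refine ⟨z, ?_, fun j => ?_⟩
      · have h3 := hm.2
        rw [hlsum] at h3
        rw [← h3, ← Finset.sum_sub_distrib]
        refine Finset.sum_congr rfl fun j _ => ?_
        rw [← hz]
        ring
      · rw [← hz, sub_sub_cancel]
        exact hθ _ hm.1 j)
  refine not_isEquidistributed_of_torusFun_eq_const hN (B.isLatticeHom_character ξ)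
    (B.continuous_character ξ) (B.character_surjective hξ) hq hmem
    (c := ((c₁ : ℝ) : UnitAddCircle)) (fun n => ?_) hequi
  -- On NΓ the torus function of ξ is the ξ-combination of the coordinate torus functions, so it is
  -- constant on the progression by `hc₁`.
  have hsum : ∀ x ∈ N ⊔ Γ, torusFun Γ (B.character ξ) x =
      ∑ j, ξ j • torusFun Γ (B.character (Pi.single j 1)) x := fun x hx => by
    obtain ⟨h, δ, hδ, rfl⟩ := mem_sup_iff_exists_mul.1 hx
    simp only [torusFun_mul_mem (B.isLatticeHom_character _) h hδ]
    have h1 : ∀ j, B.character (Pi.single j 1) h = ((B.theta h j : ℝ) : UnitAddCircle) :=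
      fun j => by
        rw [MalcevBasis.character,
          Finset.sum_eq_single_of_mem j (Finset.mem_univ j) fun k _ hk => by simp [hk]]
        simp
    simp only [h1]
    rw [MalcevBasis.character]
    simp only [← AddCircle.coe_zsmul, zsmul_eq_mul]
    exact map_sum (QuotientAddGroup.mk' (AddSubgroup.zmultiples (1 : ℝ))) _ _
  rw [hsum _ (hmem n)]
  simp only [hp, ← AddCircle.coe_zsmul, zsmul_eq_mul]
  obtain ⟨k, hk⟩ := hc₁ n
  have h1 := map_sum (QuotientAddGroup.mk' (AddSubgroup.zmultiples (1 : ℝ)))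
    (fun j => (ξ j : ℝ) * (p j).eval (n : ℝ)) Finset.univ
  refine h1.symm.trans ?_
  rw [hk]
  change (((k : ℝ) + c₁ : ℝ) : UnitAddCircle) = _
  rw [AddCircle.coe_add, add_eq_right, AddCircle.coe_eq_zero_iff]
  exact ⟨k, by simp⟩

theorem mainTheorem9 {m : ℕ} {G : Type*} [Group G] [TopologicalSpace G] [IsTopologicalGroup G]
    [ChartedSpace (EuclideanSpace ℝ (Fin m)) G] [LieGroup (𝓡 m) ∞ G]
    [Group.IsNilpotent G] [SimplyConnectedSpace (Subgroup.connectedComponentOfOne G)]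
    (Γ : Subgroup G) [DiscreteTopology Γ] [CompactSpace (G ⧸ Γ)]
    [MeasurableSpace (G ⧸ Γ)] [BorelSpace (G ⧸ Γ)]
    (C : MalcevCoordinates G Γ)
    (g : ℤ → G) (hg : IsPolynomialSequence g) (hequi : IsEquidistributed Γ g)
    (H : Subgroup G) (hH : IsClosed (H : Set G))
    (hinf : {n : ℤ | ∃ y ∈ H, C.IsFractionalPart (g n) y}.Infinite) :
    Subgroup.connectedComponentOfOne G ≤ H := by
  have : LocallyConnectedSpace G := ChartedSpace.locallyConnectedSpace (EuclideanSpace ℝ (Fin m)) G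
  have : LocallyCompactSpace G := ChartedSpace.locallyCompactSpace (EuclideanSpace ℝ (Fin m)) G
  have : T1Space G := ChartedSpace.t1Space (EuclideanSpace ℝ (Fin m)) G
  have hN : IsOpen (Subgroup.connectedComponentOfOne G : Set G) := isOpen_connectedComponent
  have : LocallyCompactSpace (Subgroup.connectedComponentOfOne G) := hN.locallyCompactSpace
  have : (Subgroup.connectedComponentOfOne G).Normal := normal_connectedComponentOfOne G
  refine le_of_infinite_fractionalParts hN C.basis C.existsUnique_rep hg hequi hH hinf ?_
  rintro n ⟨y, hy, ⟨b, hb, d, hd, rfl⟩, γ, hγ, hgn⟩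
  exact ⟨b, hb, d, hd, hy, γ, hγ, hgn⟩
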